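/- Let $\phi$ be the standard normal density, let $G$ be the standard Cauchy distribution, with density $\gamma(u)=\frac{1}{\pi(1+u^2)}$, and let $g(x)=\int\phi(x-u)\,dG(u)$. For $\theta_0\in\mathbb{R}^n$, let $P_{\theta_0}$, with expectation $E_{\theta_0}$, be the law of $X=(X_1,\dots,X_n)$ with $X_i=\theta_{0,i}+\varepsilon_i$ and $\varepsilon_1,\dots,\varepsilon_n$ i.i.d. $\mathcal N(0,1)$. For $\alpha\in[0,1]$, the posterior distribution of $\theta\in\mathbb{R}^n$ given $X$ under the spike-and-slab prior $\bigotimes_{i=1}^n\big((1-\alpha)\delta_0+\alpha G\big)$ is $$\Pi_\alpha[\cdot\,|\,X]=\bigotimes_{i=1}^n\big((1-a_\alpha(X_i))\,\delta_0+a_\alpha(X_i)\,G_{X_i}\big),\qquad a_\alpha(x)=\frac{\alpha g(x)}{(1-\alpha)\phi(x)+\alpha g(x)},$$ where $G_x$ has Lebesgue density $u\mapsto\phi(x-u)\gamma(u)/g(x)$. For $\alpha\in(0,1]$, let $t(\alpha)\ge 0$ be the number such that the median of $(1-a_\alpha(x))\delta_0+a_\alpha(x)G_x$ is $0$ if and only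 if $|x|\le t(\alpha)$, and let $\alpha_n\in(0,1]$ be the solution of $t(\alpha_n)=\sqrt{2\log n}$. Let $\hat\alpha=\hat\alpha(X)$ be a maximiser over $\alpha\in[\alpha_n,1]$ of the log-marginal likelihood $$\ell_n(\alpha;X)=\sum_{i=1}^n\log\big((1-\alpha)\phi(X_i)+\alpha g(X_i)\big),$$ and let $\Pi_{\hat\alpha}[\cdot\,|\,X]$ be the plug-in posterior, i.e. $\Pi_\alpha[\cdot\,|\,X]$ at $\alpha=\hat\alpha(X)$. For $s\ge 0$ let $\ell_0[s]=\{\theta\in\mathbb{R}^n:\#\{i:\theta_i\ne0\}\le s\}$ and $r_n=2s_n\log(n/s_n)$ (with $r_n=0$ if $s_n=0$), and let $\|\cdot\|$ be the Euclidean norm. There exist constants $C,c_0,c_1>0$ and $N_0>0$ such that, for every $n\ge N_0$: 1. for every $s_n$ with $c_1\log^2 n\le s_n\le c_0n$, $$\sup_{\theta_0\in\ell_0[s_n]}E_{\theta_0}\int\|\theta-\theta_0\|^2\,d\Pi_{\hat\alpha}(\theta\,|\,X)\le C\,r_n;$$ 2. for every $s_n$ with $0\le s_n\le c_0n$, $$\sup_{\theta_0\in\ell_0[s_n]}E_{\theta_0}\int\|\theta-\theta_0\|^2\,d\Pi_{\hat\alpha}(\theta\,|\,X)\le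 C\,r_n+C\log^3n.$$ -/

import Mathlib

open MeasureTheory ProbabilityTheory

namespace SpikeSlab

noncomputable section

/-- The standard normal density `φ`. -/
def phi (x : ℝ) : ℝ := gaussianPDFReal 0 1 x

/-- The slab distribution `G`: the standard Cauchy distribution. -/
def slab : Measure ℝ := cauchyMeasure 0 1

/-- The Lebesgue density `γ` of the slab. -/
def slabDensity (u : ℝ) : ℝ := cauchyPDFReal 0 1 u

/-- The convolution `g = φ * G`. -/
def g (x : ℝ) : ℝ := ∫ u, phi (x - u) ∂slab

/-- The law `P_θ` of `X = θ + ε`, with `ε` a vector of `n` independent standard normal variables. -/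
def dataLaw {n : ℕ} (θ : Fin n → ℝ) : Measure (Fin n → ℝ) :=
  Measure.pi fun i => gaussianReal (θ i) 1

/-- The class `ℓ₀[s]` of vectors of `ℝⁿ` with at most `s` nonzero coordinates. -/
def sparseVectors (n : ℕ) (s : ℝ) : Set (Fin n → ℝ) :=
  {θ | ((Set.ncard {i | θ i ≠ 0} : ℕ) : ℝ) ≤ s}

/-- The posterior weight `a_α(x)` of the slab, given the observation `x` of a coordinate. -/
def postWeight (α x : ℝ) : ℝ := α * g x / ((1 - α) * phi x + α * g x)

/-- The distribution `G_x`, with Lebesgue density `u ↦ φ(x - u) γ(u) / g(x)`. -/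
def slabPosterior (x : ℝ) : Measure ℝ :=
  volume.withDensity fun u => ENNReal.ofReal (phi (x - u) * slabDensity u / g x)

/-- The posterior distribution `(1 - a_α(x)) δ₀ + a_α(x) G_x` of a single coordinate under the prior
`(1 - α) δ₀ + α G`, given the observation `x` of this coordinate. -/
def coordPosterior (α x : ℝ) : Measure ℝ :=
  ENNReal.ofReal (1 - postWeight α x) • Measure.dirac 0 +
    ENNReal.ofReal (postWeight α x) • slabPosterior x

/-- The posterior distribution `Π_α[· | X]` of the whole vector. -/
def posterior {n : ℕ} (α : ℝ) (X : Fin n → ℝ) : Measure (Fin n → ℝ) :=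
  Measure.pi fun i => coordPosterior α (X i)

/-- `m` is a median of the probability distribution `μ`. -/
def IsMedian (μ : Measure ℝ) (m : ℝ) : Prop :=
  1 / 2 ≤ μ (Set.Iic m) ∧ 1 / 2 ≤ μ (Set.Ici m)

/-- The threshold `t(α)` of the posterior median: the number such that the posterior median of
a coordinate vanishes exactly when its observation `x` satisfies `|x| ≤ t(α)`. -/
def medianThreshold (α : ℝ) : ℝ :=
  Classical.epsilon fun t : ℝ => ∀ x : ℝ, IsMedian (coordPosterior α x) 0 ↔ |x| ≤ t

/-- The weight `α_n` in `(0, 1]` that solves `t(α_n) = √(2 log n)`. -/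
def alphaMin (n : ℕ) : ℝ :=
  Function.invFunOn medianThreshold (Set.Ioc 0 1) (Real.sqrt (2 * Real.log n))

/-- The log-marginal likelihood `ℓ_n(α; X)`. -/
def logMarginal {n : ℕ} (α : ℝ) (X : Fin n → ℝ) : ℝ :=
  ∑ i, Real.log ((1 - α) * phi (X i) + α * g (X i))

/-- `αhat` is a marginal maximum likelihood estimator: for all data `X`, the value `αhat X`
maximises `ℓ_n(·; X)` over the interval `[α_n, 1]`. -/
def IsMarginalMLE {n : ℕ} (αhat : (Fin n → ℝ) → ℝ) : Prop :=
  ∀ X, αhat X ∈ Set.Icc (alphaMin n) 1 ∧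
    IsMaxOn (fun α => logMarginal α X) (Set.Icc (alphaMin n) 1) (αhat X)

/-- The risk `E_{θ₀} ∫ ‖θ - θ₀‖² dΠ_{αhat}(θ | X)` of the plug-in posterior, in `[0, ∞]`. -/
def postRisk {n : ℕ} (αhat : (Fin n → ℝ) → ℝ) (θ₀ : Fin n → ℝ) : ENNReal :=
  ∫⁻ X, ∫⁻ θ, ENNReal.ofReal (∑ i, (θ i - θ₀ i) ^ 2) ∂posterior (αhat X) X ∂dataLaw θ₀

/-- The rate `r_n = 2 s log (n / s)`, which is `0` for `s = 0`. -/
def rate (n : ℕ) (s : ℝ) : ℝ := 2 * s * Real.log (n / s)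

end

end SpikeSlab

namespace SpikeSlab

/-! ### The densities `φ`, `γ` and `g` -/

/-! Each log-likelihood term is concave in the weight `α`, so the sign of the score `∑ scoreTerm α
(X i)` at a deterministic `α` in `[α_n, 1]` tells on which side of `α` the estimator lies
(`mle_sub_mul_score_nonneg`). This confines the estimator between deterministic weights, up to rare
events. The rest is a pointwise risk bound in which the random weight enters only through such
comparisons.

Zero coordinates. For a weight `α` they cost about `α * cutoff α` each
(`lintegral_postWeight_mul_le`). Under the null, the score has a negative mean of order `1 / cutoff
α`, due to the Cauchy tail of `g`, and `α` times the score is bounded; hence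
`lintegral_exp_scoreTerm_le`. A Chernoff bound shows that, except with probability `n⁻²`, the
estimator is at most `A = upperWeight n s`, of order `(s / n) √(log (n / s))`, and `n * A * cutoff
A` is of order `s log (n / s)`.

Nonzero coordinates. The slab posterior stays within bounded mean square distance of `x`, so the
only danger is shrinkage to zero. It costs at most `θ i ^ 2`, and also at most a multiple of `log
(32 / α)` plus the noise (`one_sub_postWeight_mul_signal_sq_le`). A lower bound on the estimator is
thus needed only when many signals are large. Take the largest `k` such that at least `k` of the `θ
i ^ 2` exceed `16 log (1024 n / k)` (`exists_large_subset`). All but `k` signals then have total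
energy of order `s log (n / s)`. The `k` large ones force the estimator above `k / (32 n)` except
with probability `exp (-k / 4)` (`le_mle_of_notMem_noisySet`), and `k log (n / k)` is again of order
`s log (n / s)`. On the exceptional event the constraint `α ≥ α_n ≥ 1 / (7 n)` limits the loss to
order `k log n`, which is `O(log n)` in expectation.

For `s < 4 log² n`, the class is contained in the one with `s = 4 log² n`, whose rate is of order
`log³ n`. -/

lemma phi_eq (x : ℝ) : phi x = (√(2 * Real.pi))⁻¹ * Real.exp (-x ^ 2 / 2) := by
  simp [phi, gaussianPDFReal]

lemma slabDensity_eq (u : ℝ) : slabDensity u = Real.pi⁻¹ * (1 + u ^ 2)⁻¹ := by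
  simp [slabDensity, cauchyPDFReal_def']

lemma phi_pos (x : ℝ) : 0 < phi x := gaussianPDFReal_pos _ _ _ one_ne_zero

lemma slabDensity_pos (u : ℝ) : 0 < slabDensity u := cauchyPDF_pos _ one_ne_zero _

@[fun_prop]
lemma continuous_phi : Continuous phi := by
  have : phi = fun x => (√(2 * Real.pi))⁻¹ * Real.exp (-x ^ 2 / 2) := funext phi_eq
  rw [this]; fun_prop

@[fun_prop]
lemma continuous_slabDensity : Continuous slabDensity := by
  have : slabDensity = fun x => Real.pi⁻¹ * (1 + x ^ 2)⁻¹ := funext slabDensity_eq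
  rw [this]
  exact continuous_const.mul ((by fun_prop : Continuous fun x : ℝ => 1 + x ^ 2).inv₀
    fun x => by positivity)

@[fun_prop]
lemma measurable_phi : Measurable phi := continuous_phi.measurable

@[fun_prop]
lemma measurable_slabDensity : Measurable slabDensity := continuous_slabDensity.measurable

lemma integrable_phi : Integrable phi := integrable_gaussianPDFReal 0 1

lemma integral_phi : ∫ x, phi x = 1 := integral_gaussianPDFReal_eq_one 0 one_ne_zero

lemma integrable_slabDensity : Integrable slabDensity := integrable_cauchyPDFReal 0

lemma integral_slabDensity : ∫ x, slabDensity x = 1 := integral_cauchyPDFReal_eq_one 0 one_ne_zero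

lemma two_le_sqrt_two_pi : 2 ≤ √(2 * Real.pi) :=
  Real.le_sqrt_of_sq_le (by nlinarith [Real.pi_gt_three])

lemma sqrt_two_pi_le_three : √(2 * Real.pi) ≤ 3 :=
  Real.sqrt_le_iff.2 ⟨by norm_num, by nlinarith [Real.pi_lt_d2]⟩

lemma phi_le (x : ℝ) : phi x ≤ Real.exp (-x ^ 2 / 2) / 2 := by
  rw [phi_eq, div_eq_inv_mul (Real.exp _)]
  exact mul_le_mul_of_nonneg_right (inv_anti₀ two_pos two_le_sqrt_two_pi) (Real.exp_nonneg _)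

lemma le_phi (x : ℝ) : Real.exp (-x ^ 2 / 2) / 3 ≤ phi x := by
  rw [phi_eq, div_eq_inv_mul (Real.exp _)]
  exact mul_le_mul_of_nonneg_right (inv_anti₀ (by positivity) sqrt_two_pi_le_three)
    (Real.exp_nonneg _)

lemma phi_le_one (x : ℝ) : phi x ≤ 1 := by
  have := phi_le x
  have : Real.exp (-x ^ 2 / 2) ≤ 1 := Real.exp_le_one_iff.2 (by nlinarith [sq_nonneg x])
  linarith

lemma phi_sub (x u : ℝ) : phi (x - u) = phi x * Real.exp (x * u - u ^ 2 / 2) := by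
  rw [phi_eq, phi_eq, mul_assoc, ← Real.exp_add]; congr 2; ring

lemma phi_neg (x : ℝ) : phi (-x) = phi x := by simp [phi_eq]

lemma slabDensity_neg (x : ℝ) : slabDensity (-x) = slabDensity x := by simp [slabDensity_eq]

lemma slab_eq : slab = volume.withDensity fun u => ENNReal.ofReal (slabDensity u) := by
  rw [slab, cauchyMeasure_of_scale_ne_zero 0 one_ne_zero]; rfl

lemma integrable_phi_sub_mul_slabDensity (x : ℝ) :
    Integrable fun u => phi (x - u) * slabDensity u := by
  refine integrable_slabDensity.mono' (by fun_prop) (.of_forall fun u => ?_)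
  rw [Real.norm_of_nonneg (mul_nonneg (phi_pos _).le (slabDensity_pos _).le)]
  exact mul_le_of_le_one_left (slabDensity_pos _).le (phi_le_one _)

lemma g_eq (x : ℝ) : g x = ∫ u, phi (x - u) * slabDensity u := by
  rw [g, slab_eq, integral_withDensity_eq_integral_toReal_smul (by fun_prop) (by simp)]
  refine integral_congr_ae (.of_forall fun u => ?_)
  simp [ENNReal.toReal_ofReal (slabDensity_pos u).le, mul_comm]

lemma g_eq_integral_sub (x : ℝ) : g x = ∫ v, phi v * slabDensity (x - v) := by
  rw [g_eq, ← integral_sub_left_eq_self _ _ x]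
  simp

lemma integrable_phi_mul_slabDensity_sub (x : ℝ) :
    Integrable fun v => phi v * slabDensity (x - v) := by
  simpa using (integrable_phi_sub_mul_slabDensity x).comp_sub_left x

/-- Peetre's inequality. It makes a Cauchy tail stable under a Gaussian shift `v`, at the price of a
factor `1 + v ^ 2` that Gaussian moments absorb. -/
lemma one_add_sq_le_mul (x v : ℝ) : 1 + x ^ 2 ≤ 2 * (1 + v ^ 2) * (1 + (x - v) ^ 2) := by
  nlinarith [sq_nonneg (x - 2 * v), sq_nonneg (v * (x - v))]

lemma one_add_sq_le_exp {c : ℝ} (hc : 1 ≤ c) (x : ℝ) : 1 + x ^ 2 ≤ c * Real.exp (x ^ 2 / c) := by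
  have h := Real.add_one_le_exp (x ^ 2 / c)
  have : c * (x ^ 2 / c + 1) = x ^ 2 + c := by field_simp
  nlinarith

lemma phi_mul_one_add_sq_sq_le (x : ℝ) :
    phi x * (1 + x ^ 2) ^ 2 ≤ 32 * Real.exp (-(1 / 4) * x ^ 2) := by
  have h1 := phi_le x
  have h2 := one_add_sq_le_exp (c := 8) (by norm_num) x
  have h3 : (1 + x ^ 2) ^ 2 ≤ (8 * Real.exp (x ^ 2 / 8)) ^ 2 := by gcongr
  have h4 : Real.exp (-(1 / 4) * x ^ 2) = Real.exp (-x ^ 2 / 2) * Real.exp (x ^ 2 / 8) ^ 2 := by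
    rw [← Real.exp_nat_mul, ← Real.exp_add]; congr 1; push_cast; ring
  calc phi x * (1 + x ^ 2) ^ 2 ≤ Real.exp (-x ^ 2 / 2) / 2 * (8 * Real.exp (x ^ 2 / 8)) ^ 2 := by
        gcongr
    _ = _ := by rw [h4]; ring

lemma integrable_phi_mul_one_add_sq_sq : Integrable fun x => phi x * (1 + x ^ 2) ^ 2 := by
  refine ((integrable_exp_neg_mul_sq (by norm_num : (0 : ℝ) < 1 / 4)).const_mul 32).mono'
    (by fun_prop) (.of_forall fun x => ?_)
  rw [Real.norm_of_nonneg (mul_nonneg (phi_pos _).le (by positivity))]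
  exact phi_mul_one_add_sq_sq_le x

lemma integral_phi_mul_one_add_sq_sq_le : ∫ x, phi x * (1 + x ^ 2) ^ 2 ≤ 128 := by
  calc ∫ x, phi x * (1 + x ^ 2) ^ 2 ≤ ∫ x : ℝ, 32 * Real.exp (-(1 / 4) * x ^ 2) :=
        integral_mono integrable_phi_mul_one_add_sq_sq
          ((integrable_exp_neg_mul_sq (by norm_num)).const_mul 32) phi_mul_one_add_sq_sq_le
    _ = 32 * √(Real.pi / (1 / 4)) := by rw [integral_const_mul, integral_gaussian]
    _ ≤ 32 * 4 := by
        gcongr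
        exact Real.sqrt_le_iff.2 ⟨by norm_num, by linarith [Real.pi_lt_four]⟩
    _ = 128 := by norm_num

lemma integrable_phi_mul_sq : Integrable fun x => phi x * x ^ 2 := by
  refine integrable_phi_mul_one_add_sq_sq.mono' (by fun_prop) (.of_forall fun x => ?_)
  rw [Real.norm_of_nonneg (mul_nonneg (phi_pos _).le (by positivity))]
  exact mul_le_mul_of_nonneg_left (by nlinarith [sq_nonneg x, sq_nonneg (x ^ 2)]) (phi_pos _).le

lemma integral_phi_mul_sq : ∫ x, phi x * x ^ 2 = 1 := by
  have h := variance_fun_id_gaussianReal (μ := 0) (v := 1)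
  rw [variance_eq_integral (by fun_prop)] at h
  simp only [integral_id_gaussianReal, sub_zero] at h
  rw [integral_gaussianReal_eq_integral_smul one_ne_zero] at h
  simpa [phi] using h

lemma g_le (x : ℝ) : g x ≤ 2 / (1 + x ^ 2) := by
  have key : ∀ v, phi v * slabDensity (x - v)
      ≤ 2 / Real.pi / (1 + x ^ 2) * (phi v + phi v * v ^ 2) := by
    intro v
    have h := one_add_sq_le_mul x v
    have : slabDensity (x - v) ≤ 2 / Real.pi / (1 + x ^ 2) * (1 + v ^ 2) := by
      rw [slabDensity_eq, ← mul_inv, inv_le_iff_one_le_mul₀ (by positivity)]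
      field_simp
      linarith
    calc _ ≤ phi v * (2 / Real.pi / (1 + x ^ 2) * (1 + v ^ 2)) :=
          mul_le_mul_of_nonneg_left this (phi_pos v).le
      _ = _ := by ring
  rw [g_eq_integral_sub]
  calc _ ≤ ∫ v, 2 / Real.pi / (1 + x ^ 2) * (phi v + phi v * v ^ 2) :=
        integral_mono (integrable_phi_mul_slabDensity_sub x)
          ((integrable_phi.add integrable_phi_mul_sq).const_mul _) key
    _ = 4 / Real.pi / (1 + x ^ 2) := by
        rw [integral_const_mul, integral_add integrable_phi integrable_phi_mul_sq, integral_phi,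
          integral_phi_mul_sq]
        ring
    _ ≤ _ := by
        gcongr
        rw [div_le_iff₀ Real.pi_pos]; linarith [Real.pi_gt_three]

lemma le_g (x : ℝ) : 1 / (16 * (1 + x ^ 2)) ≤ g x := by
  -- A minorant affine in `v ^ 2` needs only the first two moments of `φ`. It comes from Peetre's
  -- inequality and `(3 - v ^ 2) * (1 + v ^ 2) = 4 - (v ^ 2 - 1) ^ 2`.
  have key : ∀ v, 1 / (8 * Real.pi * (1 + x ^ 2)) * (3 * phi v - phi v * v ^ 2)
      ≤ phi v * slabDensity (x - v) := by
    intro v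
    have h := one_add_sq_le_mul (x - v) (-v)
    have h1 : 1 / (8 * Real.pi * (1 + x ^ 2)) * (3 - v ^ 2) ≤ slabDensity (x - v) := by
      rw [slabDensity_eq, ← mul_inv, ← one_div, le_div_iff₀ (by positivity)]
      have h2 : (3 - v ^ 2) * (1 + (x - v) ^ 2) ≤ 8 * (1 + x ^ 2) := by
        rcases le_or_gt (3 - v ^ 2) 0 with h0 | h0
        · nlinarith [sq_nonneg x, sq_nonneg (x - v)]
        · have h3 : (3 - v ^ 2) * (1 + v ^ 2) ≤ 4 := by nlinarith [sq_nonneg (v ^ 2 - 1)]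
          have h4 : 1 + (x - v) ^ 2 ≤ 2 * (1 + v ^ 2) * (1 + x ^ 2) := by
            simpa using h
          nlinarith [sq_nonneg x, mul_le_mul_of_nonneg_left h4 h0.le]
      rw [show 1 / (8 * Real.pi * (1 + x ^ 2)) * (3 - v ^ 2) * (Real.pi * (1 + (x - v) ^ 2))
        = (3 - v ^ 2) * (1 + (x - v) ^ 2) / (8 * (1 + x ^ 2)) by field_simp]
      rw [div_le_one (by positivity)]
      exact h2
    calc _ = phi v * (1 / (8 * Real.pi * (1 + x ^ 2)) * (3 - v ^ 2)) := by ring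
      _ ≤ _ := mul_le_mul_of_nonneg_left h1 (phi_pos v).le
  rw [g_eq_integral_sub]
  calc 1 / (16 * (1 + x ^ 2)) ≤ 1 / (4 * Real.pi * (1 + x ^ 2)) := by
        gcongr
        linarith [Real.pi_lt_four]
    _ = ∫ v, 1 / (8 * Real.pi * (1 + x ^ 2)) * (3 * phi v - phi v * v ^ 2) := by
        rw [integral_const_mul, integral_sub (integrable_phi.const_mul 3) integrable_phi_mul_sq,
          integral_const_mul, integral_phi, integral_phi_mul_sq]
        field_simp; norm_num
    _ ≤ _ := integral_mono (((integrable_phi.const_mul 3).sub integrable_phi_mul_sq).const_mul _)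
          (integrable_phi_mul_slabDensity_sub x) key

lemma g_pos (x : ℝ) : 0 < g x := lt_of_lt_of_le (by positivity) (le_g x)

@[fun_prop]
lemma measurable_g : Measurable g := by
  have h : StronglyMeasurable fun x => ∫ u, phi (x - u) * slabDensity u :=
    StronglyMeasurable.integral_prod_right (f := fun x u => phi (x - u) * slabDensity u)
      (by unfold Function.uncurry; fun_prop : Measurable _).stronglyMeasurable
  rw [show g = fun x => ∫ u, phi (x - u) * slabDensity u from funext g_eq]
  exact h.measurable

lemma integrable_g : Integrable g := by
  refine (integrable_slabDensity.const_mul (2 * Real.pi)).mono' (by fun_prop)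
    (.of_forall fun x => ?_)
  rw [Real.norm_of_nonneg (g_pos x).le, slabDensity_eq]
  refine (g_le x).trans_eq ?_
  field_simp

lemma integral_g : ∫ x, g x = 1 := by
  have hint : Integrable (fun p : ℝ × ℝ => phi (p.1 - p.2) * slabDensity p.2)
      (volume.prod volume) := by
    simpa [mul_comm] using integrable_slabDensity.convolution_integrand
      (ContinuousLinearMap.mul ℝ ℝ) integrable_phi
  simp_rw [g_eq]
  rw [integral_integral_swap hint]
  simp_rw [integral_mul_const, integral_sub_right_eq_self phi, integral_phi, one_mul]
  exact integral_slabDensity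

/-- The likelihood ratio `g / φ` grows at least like `exp (x ^ 2 / 4)`. -/
lemma exp_mul_phi_le (x : ℝ) : Real.exp (x ^ 2 / 4) * phi x ≤ 32 * g x := by
  have h1 := phi_le x
  have h2 := one_add_sq_le_exp (c := 4) (by norm_num) x
  have h3 := le_g x
  have h4 : Real.exp (-x ^ 2 / 2) * Real.exp (x ^ 2 / 4) * Real.exp (x ^ 2 / 4) = 1 := by
    rw [← Real.exp_add, ← Real.exp_add, ← Real.exp_zero]; congr 1; ring
  have h5 : 1 ≤ 16 * g x * (1 + x ^ 2) := by
    rw [div_le_iff₀ (by positivity)] at h3; linarith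
  have e1 := Real.exp_pos (x ^ 2 / 4)
  have e2 := Real.exp_pos (-x ^ 2 / 2)
  have h6 : 1 ≤ 16 * g x * (4 * Real.exp (x ^ 2 / 4)) :=
    h5.trans (mul_le_mul_of_nonneg_left h2 (by linarith [g_pos x]))
  calc Real.exp (x ^ 2 / 4) * phi x ≤ Real.exp (x ^ 2 / 4) * (Real.exp (-x ^ 2 / 2) / 2) := by gcongr
    _ ≤ Real.exp (x ^ 2 / 4) * (Real.exp (-x ^ 2 / 2) / 2) * (16 * g x * (4 * Real.exp (x ^ 2 / 4))) :=
        le_mul_of_one_le_right (by positivity) h6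
    _ = 32 * g x * (Real.exp (-x ^ 2 / 2) * Real.exp (x ^ 2 / 4) * Real.exp (x ^ 2 / 4)) := by ring
    _ = _ := by rw [h4, mul_one]

lemma g_le_phi_mul (x : ℝ) : g x ≤ 6 * Real.exp (x ^ 2 / 2) * phi x := by
  have h1 := le_phi x
  have h2 := g_le x
  have h3 : 2 / (1 + x ^ 2) ≤ 2 := div_le_self (by norm_num) (by nlinarith [sq_nonneg x])
  have h4 : Real.exp (x ^ 2 / 2) * Real.exp (-x ^ 2 / 2) = 1 := by
    rw [← Real.exp_add, ← Real.exp_zero]; congr 1; ring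
  calc g x ≤ 6 * Real.exp (x ^ 2 / 2) * (Real.exp (-x ^ 2 / 2) / 3) := by linarith
    _ ≤ _ := by gcongr

/-! ### The one-coordinate posterior -/

lemma mixture_pos {α : ℝ} (h0 : 0 ≤ α) (h1 : α ≤ 1) (x : ℝ) :
    0 < (1 - α) * phi x + α * g x := by
  rcases h0.eq_or_lt with rfl | h
  · simpa using phi_pos x
  · exact add_pos_of_nonneg_of_pos (mul_nonneg (by linarith) (phi_pos x).le) (mul_pos h (g_pos x))

lemma postWeight_nonneg {α : ℝ} (h0 : 0 ≤ α) (h1 : α ≤ 1) (x : ℝ) : 0 ≤ postWeight α x :=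
  div_nonneg (mul_nonneg h0 (g_pos x).le) (mixture_pos h0 h1 x).le

lemma one_sub_postWeight {α : ℝ} (h0 : 0 ≤ α) (h1 : α ≤ 1) (x : ℝ) :
    1 - postWeight α x = (1 - α) * phi x / ((1 - α) * phi x + α * g x) := by
  have := mixture_pos h0 h1 x
  rw [postWeight, eq_div_iff this.ne', sub_mul, div_mul_cancel₀ _ this.ne']
  ring

lemma postWeight_le_one {α : ℝ} (h0 : 0 ≤ α) (h1 : α ≤ 1) (x : ℝ) : postWeight α x ≤ 1 := by
  have : 0 ≤ 1 - postWeight α x := by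
    rw [one_sub_postWeight h0 h1]
    exact div_nonneg (mul_nonneg (by linarith) (phi_pos x).le) (mixture_pos h0 h1 x).le
  linarith

lemma postWeight_mono {α β : ℝ} (h0 : 0 ≤ α) (h : α ≤ β) (h1 : β ≤ 1) (x : ℝ) :
    postWeight α x ≤ postWeight β x := by
  rw [postWeight, postWeight, div_le_div_iff₀ (mixture_pos h0 (h.trans h1) x)
    (mixture_pos (h0.trans h) h1 x)]
  have := mul_pos (phi_pos x) (g_pos x)
  nlinarith [mul_le_mul_of_nonneg_right h this.le]

@[fun_prop]
lemma measurable_postWeight (α : ℝ) : Measurable (postWeight α) := by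
  unfold postWeight; fun_prop

lemma slabPosterior_apply (x : ℝ) {s : Set ℝ} (hs : MeasurableSet s) :
    slabPosterior x s = ENNReal.ofReal ((∫ u in s, phi (x - u) * slabDensity u) / g x) := by
  rw [slabPosterior, withDensity_apply _ hs, ← integral_div,
    ofReal_integral_eq_lintegral_ofReal]
  · exact ((integrable_phi_sub_mul_slabDensity x).div_const _).integrableOn
  · exact .of_forall fun u =>
      div_nonneg (mul_nonneg (phi_pos _).le (slabDensity_pos _).le) (g_pos x).le

instance isProbabilityMeasure_slabPosterior (x : ℝ) : IsProbabilityMeasure (slabPosterior x) := by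
  constructor
  rw [slabPosterior_apply x .univ, setIntegral_univ, ← g_eq, div_self (g_pos x).ne',
    ENNReal.ofReal_one]

lemma isProbabilityMeasure_coordPosterior {α : ℝ} (h0 : 0 ≤ α) (h1 : α ≤ 1) (x : ℝ) :
    IsProbabilityMeasure (coordPosterior α x) := by
  constructor
  have := postWeight_nonneg h0 h1 x
  have := postWeight_le_one h0 h1 x
  simp only [coordPosterior, Measure.add_apply, Measure.smul_apply, measure_univ, smul_eq_mul,
    mul_one]
  rw [← ENNReal.ofReal_add (by linarith) (by linarith)]
  simp

/-! ### The threshold of the posterior median -/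

/-- The positive part `∫_{u > 0} exp (x u - u² / 2) γ(u) du` of the likelihood ratio `g / φ`. -/
noncomputable def posRatio (x : ℝ) : ℝ :=
  ∫ u in Set.Ioi 0, Real.exp (x * u - u ^ 2 / 2) * slabDensity u

/-- The posterior median of a coordinate vanishes iff
`α * (posRatio |x| - posRatio (-|x|)) ≤ 1 - α`. -/
noncomputable def ratioGap (x : ℝ) : ℝ := posRatio x - posRatio (-x)

lemma integrable_exp_mul_slabDensity (x : ℝ) :
    Integrable fun u => Real.exp (x * u - u ^ 2 / 2) * slabDensity u := by
  refine ((integrable_phi_sub_mul_slabDensity x).const_mul (phi x)⁻¹).congr (.of_forall fun u => ?_)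
  have := (phi_pos x).ne'
  simp only [phi_sub]
  field_simp

lemma setIntegral_Ioi_eq (x : ℝ) :
    ∫ u in Set.Ioi 0, phi (x - u) * slabDensity u = phi x * posRatio x := by
  rw [posRatio, ← integral_const_mul]
  simp_rw [phi_sub, mul_assoc]

lemma setIntegral_Iic_eq (x : ℝ) :
    ∫ u in Set.Iic 0, phi (x - u) * slabDensity u = phi x * posRatio (-x) := by
  rw [← phi_neg x, ← setIntegral_Ioi_eq, ← neg_zero, ← integral_comp_neg_Iic, neg_zero]
  refine setIntegral_congr_fun measurableSet_Iic fun u _ => ?_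
  simp only [slabDensity_neg]
  rw [← phi_neg]
  congr 2; ring

lemma g_eq_phi_mul (x : ℝ) : g x = phi x * (posRatio x + posRatio (-x)) := by
  rw [g_eq, ← integral_add_compl measurableSet_Ioi (integrable_phi_sub_mul_slabDensity x),
    Set.compl_Ioi, setIntegral_Ioi_eq, setIntegral_Iic_eq]
  ring

lemma posRatio_nonneg (x : ℝ) : 0 ≤ posRatio x :=
  integral_nonneg fun _ => mul_nonneg (Real.exp_nonneg _) (slabDensity_pos _).le

lemma strictMono_posRatio : StrictMono posRatio := by
  intro x y h
  have hpos : 0 < ∫ u in Set.Ioi 0, (Real.exp (y * u - u ^ 2 / 2) * slabDensity u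
      - Real.exp (x * u - u ^ 2 / 2) * slabDensity u) := by
    have key : ∀ u ∈ Set.Ioi (0 : ℝ), 0 < Real.exp (y * u - u ^ 2 / 2) * slabDensity u
        - Real.exp (x * u - u ^ 2 / 2) * slabDensity u := by
      intro u hu
      rw [sub_pos]
      refine mul_lt_mul_of_pos_right (Real.exp_lt_exp.2 ?_) (slabDensity_pos u)
      have : x * u < y * u := mul_lt_mul_of_pos_right h hu
      linarith
    rw [setIntegral_pos_iff_support_of_nonneg_ae]
    · have : Set.Ioi (0 : ℝ) ⊆ (Function.support fun u => Real.exp (y * u - u ^ 2 / 2) *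
          slabDensity u - Real.exp (x * u - u ^ 2 / 2) * slabDensity u) ∩ Set.Ioi 0 :=
        fun u hu => ⟨(key u hu).ne', hu⟩
      exact lt_of_lt_of_le (by simp) (measure_mono this)
    · exact (ae_restrict_iff' measurableSet_Ioi).2 (.of_forall fun u hu => (key u hu).le)
    · exact ((integrable_exp_mul_slabDensity y).sub (integrable_exp_mul_slabDensity x)).integrableOn
  rw [integral_sub (integrable_exp_mul_slabDensity y).integrableOn
    (integrable_exp_mul_slabDensity x).integrableOn] at hpos
  exact sub_pos.1 hpos

lemma continuous_posRatio : Continuous posRatio := by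
  refine continuous_iff_continuousAt.2 fun x => ?_
  refine continuousAt_of_dominated (bound := fun u => Real.exp ((x + 1) * u - u ^ 2 / 2) *
    slabDensity u) (.of_forall fun y => (by fun_prop)) ?_
    (integrable_exp_mul_slabDensity _).integrableOn (.of_forall fun u => (by fun_prop))
  filter_upwards [Iio_mem_nhds (lt_add_one x)] with y hy
  refine (ae_restrict_iff' measurableSet_Ioi).2 (.of_forall fun u hu => ?_)
  rw [Real.norm_of_nonneg (mul_nonneg (Real.exp_nonneg _) (slabDensity_pos _).le)]
  have : y * u ≤ (x + 1) * u := mul_le_mul_of_nonneg_right (le_of_lt hy) (le_of_lt hu)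
  exact mul_le_mul_of_nonneg_right (Real.exp_le_exp.2 (by linarith)) (slabDensity_pos u).le

lemma posRatio_le_one {x : ℝ} (hx : x ≤ 0) : posRatio x ≤ 1 := by
  calc posRatio x ≤ ∫ u in Set.Ioi 0, slabDensity u := by
        refine setIntegral_mono_on (integrable_exp_mul_slabDensity x).integrableOn
          integrable_slabDensity.integrableOn measurableSet_Ioi fun u hu => ?_
        refine mul_le_of_le_one_left (slabDensity_pos u).le (Real.exp_le_one_iff.2 ?_)
        have : x * u ≤ 0 := mul_nonpos_of_nonpos_of_nonneg hx (le_of_lt hu)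
        nlinarith [sq_nonneg u]
    _ ≤ ∫ u, slabDensity u :=
        setIntegral_le_integral integrable_slabDensity (.of_forall fun u => (slabDensity_pos u).le)
    _ = 1 := integral_slabDensity

lemma strictMono_ratioGap : StrictMono ratioGap := fun _ _ h =>
  sub_lt_sub (strictMono_posRatio h) (strictMono_posRatio (neg_lt_neg h))

lemma ratioGap_neg (x : ℝ) : ratioGap (-x) = -ratioGap x := by simp [ratioGap]

lemma ratioGap_zero : ratioGap 0 = 0 := by simp [ratioGap]

lemma ratioGap_nonneg {x : ℝ} (hx : 0 ≤ x) : 0 ≤ ratioGap x :=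
  ratioGap_zero ▸ strictMono_ratioGap.monotone hx

lemma continuous_ratioGap : Continuous ratioGap :=
  continuous_posRatio.sub (continuous_posRatio.comp continuous_neg)

lemma abs_ratioGap (x : ℝ) : |ratioGap x| = ratioGap |x| := by
  rcases le_total 0 x with h | h
  · rw [abs_of_nonneg h, abs_of_nonneg (ratioGap_nonneg h)]
  · rw [abs_of_nonpos h, ratioGap_neg, abs_of_nonpos]
    have := ratioGap_nonneg (neg_nonneg.2 h)
    rw [ratioGap_neg] at this
    linarith

lemma ratioGap_le {x : ℝ} : ratioGap x ≤ 6 * Real.exp (x ^ 2 / 2) := by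
  have h := g_le_phi_mul x
  rw [g_eq_phi_mul, mul_comm (phi x)] at h
  have h' := le_of_mul_le_mul_right h (phi_pos x)
  have := posRatio_nonneg (-x)
  unfold ratioGap
  linarith

lemma le_ratioGap {x : ℝ} (hx : 0 ≤ x) :
    Real.exp (x ^ 2 / 2) / (8 * (1 + x ^ 2)) - 2 ≤ ratioGap x := by
  have h2 := posRatio_le_one (neg_nonpos.2 hx)
  have h3 : Real.exp (x ^ 2 / 2) / (8 * (1 + x ^ 2)) ≤ posRatio x + posRatio (-x) := by
    refine le_of_mul_le_mul_left ?_ (phi_pos x)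
    rw [← g_eq_phi_mul]
    refine le_trans ?_ (le_g x)
    have h4 : Real.exp (-x ^ 2 / 2) * Real.exp (x ^ 2 / 2) = 1 := by
      rw [← Real.exp_add, ← Real.exp_zero]; congr 1; ring
    calc phi x * (Real.exp (x ^ 2 / 2) / (8 * (1 + x ^ 2)))
        ≤ Real.exp (-x ^ 2 / 2) / 2 * (Real.exp (x ^ 2 / 2) / (8 * (1 + x ^ 2))) := by
          gcongr
          exact phi_le x
      _ = Real.exp (-x ^ 2 / 2) * Real.exp (x ^ 2 / 2) / (16 * (1 + x ^ 2)) := by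
          field_simp; norm_num
      _ = _ := by rw [h4]
  unfold ratioGap
  linarith

lemma exists_ratioGap_eq {y : ℝ} (hy : 0 ≤ y) : ∃ t, 0 ≤ t ∧ ratioGap t = y := by
  -- Half of the exponent absorbs `1 + x ^ 2`, leaving at least `exp (x ^ 2 / 4) / 32 - 2`, which
  -- exceeds `x ^ 2 / 128 - 2`.
  have hx : y ≤ ratioGap (128 * (y + 2)) := by
    refine le_trans ?_ (le_ratioGap (by positivity))
    set x := 128 * (y + 2) with hxdef
    have h1 := one_add_sq_le_exp (c := 4) (by norm_num) x
    have h2 := Real.add_one_le_exp (x ^ 2 / 4)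
    have h3 : Real.exp (x ^ 2 / 2) = Real.exp (x ^ 2 / 4) * Real.exp (x ^ 2 / 4) := by
      rw [← Real.exp_add]; congr 1; ring
    have h4 : Real.exp (x ^ 2 / 4) / 32 ≤ Real.exp (x ^ 2 / 2) / (8 * (1 + x ^ 2)) := by
      rw [h3, div_le_div_iff₀ (by norm_num) (by positivity)]
      nlinarith [Real.exp_pos (x ^ 2 / 4)]
    nlinarith
  obtain ⟨t, ht, h⟩ := intermediate_value_Icc (by positivity : (0 : ℝ) ≤ 128 * (y + 2))
    continuous_ratioGap.continuousOn ⟨ratioGap_zero.le.trans hy, hx⟩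
  exact ⟨t, ht.1, h⟩

/-- Meant for the two closed half-lines at `0`: both contain the atom, so each gets the whole spike
mass, and the common factor `φ x` cancels. -/
lemma coordPosterior_apply {α : ℝ} (h0 : 0 ≤ α) (h1 : α ≤ 1) (x : ℝ) {s : Set ℝ}
    (hs : MeasurableSet s) (h0s : 0 ∈ s) {p : ℝ} (hp : 0 ≤ p)
    (h : ∫ u in s, phi (x - u) * slabDensity u = phi x * p) :
    1 / 2 ≤ coordPosterior α x s ↔
      (1 - α) + α * (posRatio x + posRatio (-x)) ≤ 2 * ((1 - α) + α * p) := by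
  have hφ := phi_pos x
  have hg := g_pos x
  have hD := mixture_pos h0 h1 x
  have ha := postWeight_nonneg h0 h1 x
  have ha' := postWeight_le_one h0 h1 x
  have hq : 0 ≤ phi x * p / g x := by positivity
  have e : coordPosterior α x s = ENNReal.ofReal
      (phi x * ((1 - α) + α * p) / ((1 - α) * phi x + α * g x)) := by
    simp only [coordPosterior, Measure.add_apply, Measure.smul_apply, smul_eq_mul,
      Measure.dirac_apply' _ hs, slabPosterior_apply x hs, h, Set.indicator_of_mem h0s,
      Pi.one_apply, mul_one]
    rw [← ENNReal.ofReal_mul ha, ← ENNReal.ofReal_add (by linarith) (by positivity),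
      one_sub_postWeight h0 h1, postWeight]
    congr 1
    field_simp
  have e2 : (1 / 2 : ENNReal) = ENNReal.ofReal (1 / 2) := by
    rw [ENNReal.ofReal_div_of_pos two_pos]; simp
  rw [e, e2, ENNReal.ofReal_le_ofReal_iff (by
      have : 0 ≤ 1 - α := by linarith
      positivity), le_div_iff₀ hD, g_eq_phi_mul]
  rw [show 1 / 2 * ((1 - α) * phi x + α * (phi x * (posRatio x + posRatio (-x))))
    = phi x * (((1 - α) + α * (posRatio x + posRatio (-x))) / 2) by ring,
    mul_le_mul_iff_right₀ hφ, div_le_iff₀ two_pos, mul_comm _ (2 : ℝ)]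

lemma isMedian_zero_iff {α : ℝ} (h0 : 0 ≤ α) (h1 : α ≤ 1) (x : ℝ) :
    IsMedian (coordPosterior α x) 0 ↔ α * ratioGap |x| ≤ 1 - α := by
  rw [IsMedian, coordPosterior_apply h0 h1 x measurableSet_Iic (by simp) (posRatio_nonneg (-x))
    (setIntegral_Iic_eq x), coordPosterior_apply h0 h1 x measurableSet_Ici (by simp)
    (posRatio_nonneg x) (by rw [integral_Ici_eq_integral_Ioi, setIntegral_Ioi_eq]),
    ← abs_ratioGap, ← abs_of_nonneg h0, ← abs_mul, abs_of_nonneg h0, abs_le, ratioGap]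
  constructor
  · rintro ⟨h, h'⟩
    constructor <;> linarith
  · rintro ⟨h, h'⟩
    constructor <;> linarith

/-- The property defining the threshold has at most one nonnegative solution: two solutions are
compared by testing the equivalence at each of them. Hence the choice operator has to return `t`. -/
lemma medianThreshold_spec {α : ℝ} (h0 : 0 < α) (h1 : α ≤ 1) {t : ℝ} (ht : 0 ≤ t)
    (h : ratioGap t = (1 - α) / α) : medianThreshold α = t := by
  have hspec : ∀ x : ℝ, IsMedian (coordPosterior α x) 0 ↔ |x| ≤ t := by
    intro x
    rw [isMedian_zero_iff h0.le h1, ← strictMono_ratioGap.le_iff_le (b := t), h, le_div_iff₀ h0, mul_comm]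
  have heps := Classical.epsilon_spec
    (p := fun t : ℝ => ∀ x : ℝ, IsMedian (coordPosterior α x) 0 ↔ |x| ≤ t) ⟨t, hspec⟩
  have key : ∀ x : ℝ, |x| ≤ t ↔ |x| ≤ medianThreshold α := fun x =>
    (hspec x).symm.trans (heps x)
  have h2 : t ≤ medianThreshold α := by simpa [abs_of_nonneg ht] using (key t).1 (abs_of_nonneg ht).le
  refine le_antisymm ?_ h2
  simpa [abs_of_nonneg (ht.trans h2)] using
    (key (medianThreshold α)).2 (abs_of_nonneg (ht.trans h2)).le

/-- The explicit weight shows that the equation is solvable in `(0, 1]`, so the chosen inverse is a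
genuine solution. The equation `ratioGap t = (1 - α) / α` then determines it. -/
lemma alphaMin_eq (n : ℕ) :
    alphaMin n = 1 / (1 + ratioGap √(2 * Real.log n)) := by
  set T := √(2 * Real.log n) with hT
  have hT0 : 0 ≤ T := Real.sqrt_nonneg _
  have hH := ratioGap_nonneg hT0
  have hex : ∃ α ∈ Set.Ioc (0 : ℝ) 1, medianThreshold α = T := by
    refine ⟨1 / (1 + ratioGap T), ⟨by positivity, ?_⟩, ?_⟩
    · rw [div_le_one (by positivity)]; linarith
    · refine medianThreshold_spec (by positivity) ?_ hT0 ?_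
      · rw [div_le_one (by positivity)]; linarith
      · field_simp; ring
  have hmem : alphaMin n ∈ Set.Ioc (0 : ℝ) 1 := Function.invFunOn_mem hex
  have heq : medianThreshold (alphaMin n) = T := Function.invFunOn_eq hex
  obtain ⟨t, ht, h⟩ := exists_ratioGap_eq
    (div_nonneg (sub_nonneg.2 hmem.2) hmem.1.le : 0 ≤ (1 - alphaMin n) / alphaMin n)
  have ht' : t = T := (medianThreshold_spec hmem.1 hmem.2 ht h).symm.trans heq
  have := hmem.1
  rw [← ht', h]
  field_simp; ring

lemma alphaMin_pos (n : ℕ) : 0 < alphaMin n := by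
  have := ratioGap_nonneg (Real.sqrt_nonneg (2 * Real.log n))
  rw [alphaMin_eq]; positivity

lemma exp_sqrt_two_log_sq {n : ℕ} (hn : 0 < n) :
    √(2 * Real.log n) ^ 2 = 2 * Real.log n ∧ Real.exp (√(2 * Real.log n) ^ 2 / 2) = n := by
  have h : √(2 * Real.log n) ^ 2 = 2 * Real.log n :=
    Real.sq_sqrt (mul_nonneg two_pos.le (Real.log_natCast_nonneg n))
  refine ⟨h, ?_⟩
  rw [h, mul_div_cancel_left₀ _ two_ne_zero, Real.exp_log (by exact_mod_cast hn)]

lemma one_div_le_alphaMin {n : ℕ} (hn : 0 < n) : 1 / (7 * n) ≤ alphaMin n := by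
  have hn' : (1 : ℝ) ≤ n := by exact_mod_cast hn
  have h := ratioGap_le (x := √(2 * Real.log n))
  have h0 := ratioGap_nonneg (Real.sqrt_nonneg (2 * Real.log n))
  rw [(exp_sqrt_two_log_sq hn).2] at h
  rw [alphaMin_eq]
  gcongr
  linarith

lemma alphaMin_le {n : ℕ} (hn : 0 < n) (hlog : 1 ≤ Real.log n) (hlarge : 48 * Real.log n ≤ n) :
    alphaMin n ≤ 48 * Real.log n / n := by
  have hn' : (1 : ℝ) ≤ n := by exact_mod_cast hn
  have h := le_ratioGap (Real.sqrt_nonneg (2 * Real.log n))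
  rw [(exp_sqrt_two_log_sq hn).2, (exp_sqrt_two_log_sq hn).1] at h
  have h0 := ratioGap_nonneg (Real.sqrt_nonneg (2 * Real.log n))
  have h1 : n / (24 * Real.log n) ≤ n / (8 * (1 + 2 * Real.log n)) := by
    exact div_le_div_of_nonneg_left (by linarith) (by linarith) (by linarith)
  have h2 : n / (24 * Real.log n) = 2 * (n / (48 * Real.log n)) := by
    field_simp; norm_num
  have h3 : 1 ≤ n / (48 * Real.log n) := by rw [one_le_div (by positivity)]; exact hlarge
  rw [alphaMin_eq, div_le_iff₀ (by positivity)]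
  have h4 : n / (48 * Real.log n) ≤ 1 + ratioGap √(2 * Real.log n) := by linarith
  calc (1 : ℝ) = 48 * Real.log n / n * (n / (48 * Real.log n)) := by field_simp
    _ ≤ _ := by gcongr

/-! ### Quadratic risk of the posterior -/

/-- The ratio `γ u / g x` grows at most quadratically in `x - u`, by Peetre's inequality and the
lower bound on `g`; the constant is `32 / π ≤ 11`. So the Cauchy slab shrinks large observations
only by a bounded amount. -/
lemma slabPosterior_density_mul_sq_le (x u : ℝ) :
    phi (x - u) * slabDensity u / g x * (u - x) ^ 2
      ≤ 11 * (phi (x - u) * (1 + (x - u) ^ 2) ^ 2) := by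
  have h1 := one_add_sq_le_mul x (x - u)
  rw [sub_sub_cancel] at h1
  have h2 : slabDensity u ≤ 11 * (1 + (x - u) ^ 2) * g x := by
    calc slabDensity u ≤ 11 * (1 + (x - u) ^ 2) * (1 / (16 * (1 + x ^ 2))) := by
          rw [slabDensity_eq, ← mul_inv, inv_le_iff_one_le_mul₀ (by positivity)]
          rw [show 11 * (1 + (x - u) ^ 2) * (1 / (16 * (1 + x ^ 2))) * (Real.pi * (1 + u ^ 2))
            = (11 * Real.pi * ((1 + (x - u) ^ 2) * (1 + u ^ 2))) / (16 * (1 + x ^ 2)) by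
              field_simp]
          rw [one_le_div (by positivity)]
          have : 32 * ((1 + (x - u) ^ 2) * (1 + u ^ 2))
              ≤ 11 * Real.pi * ((1 + (x - u) ^ 2) * (1 + u ^ 2)) := by
            gcongr
            linarith [Real.pi_gt_three]
          linarith
      _ ≤ _ := by
          gcongr
          exact le_g x
  have hg := g_pos x
  have hφ := phi_pos (x - u)
  have h3 : slabDensity u / g x ≤ 11 * (1 + (x - u) ^ 2) := by rwa [div_le_iff₀ hg]
  calc phi (x - u) * slabDensity u / g x * (u - x) ^ 2
      = phi (x - u) * (slabDensity u / g x) * (u - x) ^ 2 := by ring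
    _ ≤ phi (x - u) * (11 * (1 + (x - u) ^ 2)) * (1 + (x - u) ^ 2) := by
        gcongr
        nlinarith
    _ = _ := by ring

lemma lintegral_slabPosterior_sq_le (x : ℝ) :
    ∫⁻ u, ENNReal.ofReal ((u - x) ^ 2) ∂slabPosterior x ≤ ENNReal.ofReal 1408 := by
  rw [slabPosterior, lintegral_withDensity_eq_lintegral_mul _ (by fun_prop) (by fun_prop)]
  have hint : Integrable fun u => 11 * (phi (x - u) * (1 + (x - u) ^ 2) ^ 2) :=
    (integrable_phi_mul_one_add_sq_sq.comp_sub_left x).const_mul 11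
  calc _ ≤ ∫⁻ u, ENNReal.ofReal (11 * (phi (x - u) * (1 + (x - u) ^ 2) ^ 2)) := by
        refine lintegral_mono fun u => ?_
        simp only [Pi.mul_apply]
        rw [← ENNReal.ofReal_mul (div_nonneg (mul_nonneg (phi_pos _).le (slabDensity_pos _).le)
          (g_pos x).le)]
        exact ENNReal.ofReal_le_ofReal (slabPosterior_density_mul_sq_le x u)
    _ = ENNReal.ofReal (∫ u, 11 * (phi (x - u) * (1 + (x - u) ^ 2) ^ 2)) := by
        rw [ofReal_integral_eq_lintegral_ofReal hint (.of_forall fun u => by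
          have := phi_pos (x - u); positivity)]
    _ ≤ _ := by
        refine ENNReal.ofReal_le_ofReal ?_
        rw [integral_const_mul,
          integral_sub_left_eq_self (fun v => phi v * (1 + v ^ 2) ^ 2)]
        linarith [integral_phi_mul_one_add_sq_sq_le]

lemma lintegral_slabPosterior_sq_sub_le (x μ : ℝ) :
    ∫⁻ u, ENNReal.ofReal ((u - μ) ^ 2) ∂slabPosterior x
      ≤ ENNReal.ofReal (2816 + 2 * (x - μ) ^ 2) := by
  calc _ ≤ ∫⁻ u, (ENNReal.ofReal 2 * ENNReal.ofReal ((u - x) ^ 2)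
        + ENNReal.ofReal (2 * (x - μ) ^ 2)) ∂slabPosterior x := by
        refine lintegral_mono fun u => ?_
        rw [← ENNReal.ofReal_mul (by norm_num), ← ENNReal.ofReal_add (by positivity)
          (by positivity)]
        exact ENNReal.ofReal_le_ofReal (by nlinarith [sq_nonneg (u - x - (x - μ))])
    _ ≤ ENNReal.ofReal 2 * ENNReal.ofReal 1408 + ENNReal.ofReal (2 * (x - μ) ^ 2) := by
        rw [lintegral_add_left (by fun_prop), lintegral_const_mul _ (by fun_prop),
          lintegral_const, measure_univ, mul_one]
        gcongr
        exact lintegral_slabPosterior_sq_le x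
    _ = _ := by
        rw [← ENNReal.ofReal_mul (by norm_num), ← ENNReal.ofReal_add (by norm_num) (by positivity)]
        norm_num

lemma lintegral_coordPosterior_sq_sub_le {α : ℝ} (h0 : 0 ≤ α) (h1 : α ≤ 1) (x μ : ℝ) :
    ∫⁻ u, ENNReal.ofReal ((u - μ) ^ 2) ∂coordPosterior α x ≤ ENNReal.ofReal
      ((1 - postWeight α x) * μ ^ 2 + postWeight α x * (2816 + 2 * (x - μ) ^ 2)) := by
  have ha := postWeight_nonneg h0 h1 x
  have ha' : 0 ≤ 1 - postWeight α x := sub_nonneg.2 (postWeight_le_one h0 h1 x)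
  rw [coordPosterior, lintegral_add_measure, lintegral_smul_measure, lintegral_smul_measure,
    lintegral_dirac' _ (by fun_prop), smul_eq_mul, smul_eq_mul,
    ENNReal.ofReal_add (by positivity) (by positivity), ENNReal.ofReal_mul ha',
    ENNReal.ofReal_mul ha, zero_sub, neg_sq]
  gcongr
  exact lintegral_slabPosterior_sq_sub_le x μ

lemma lintegral_pi_eval {n : ℕ} (μ : Fin n → Measure ℝ) [∀ i, IsProbabilityMeasure (μ i)]
    (i : Fin n) {f : ℝ → ENNReal} (hf : Measurable f) :
    ∫⁻ x, f (x i) ∂Measure.pi μ = ∫⁻ y, f y ∂μ i :=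
  (measurePreserving_eval μ i).lintegral_comp hf

lemma lintegral_posterior_le {n : ℕ} {α : ℝ} (h0 : 0 ≤ α) (h1 : α ≤ 1) (X θ₀ : Fin n → ℝ) :
    ∫⁻ θ, ENNReal.ofReal (∑ i, (θ i - θ₀ i) ^ 2) ∂posterior α X ≤ ENNReal.ofReal
      (∑ i, ((1 - postWeight α (X i)) * θ₀ i ^ 2
        + postWeight α (X i) * (2816 + 2 * (X i - θ₀ i) ^ 2))) := by
  have := fun i => isProbabilityMeasure_coordPosterior h0 h1 (X i)
  calc _ = ∑ i, ∫⁻ θ, ENNReal.ofReal ((θ i - θ₀ i) ^ 2) ∂posterior α X := by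
        simp_rw [ENNReal.ofReal_sum_of_nonneg fun i _ => sq_nonneg _]
        exact lintegral_finsetSum _ fun i _ => by fun_prop
    _ = ∑ i, ∫⁻ u, ENNReal.ofReal ((u - θ₀ i) ^ 2) ∂coordPosterior α (X i) :=
        Finset.sum_congr rfl fun i _ => lintegral_pi_eval (fun i => coordPosterior α (X i)) i
          (f := fun u => ENNReal.ofReal ((u - θ₀ i) ^ 2)) (by fun_prop)
    _ ≤ _ := by
        rw [ENNReal.ofReal_sum_of_nonneg]
        · exact Finset.sum_le_sum fun i _ => lintegral_coordPosterior_sq_sub_le h0 h1 _ _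
        · intro i _
          have ha := postWeight_nonneg h0 h1 (X i)
          have ha' : 0 ≤ 1 - postWeight α (X i) := sub_nonneg.2 (postWeight_le_one h0 h1 _)
          positivity

/-! ### The threshold at which the likelihood ratio compensates the weight `α` -/

/-- A value `t` such that `φ ≤ α g` outside `[-t, t]`. -/
noncomputable def cutoff (α : ℝ) : ℝ := √(4 * Real.log (32 / α))

lemma three_le_log_div {α : ℝ} (h0 : 0 < α) (h1 : α ≤ 1) : 3 ≤ Real.log (32 / α) := by
  rw [Real.le_log_iff_exp_le (by positivity)]
  have h2 : (32 : ℝ) ≤ 32 / α := by rw [le_div_iff₀ h0]; linarith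
  have h3 : Real.exp 3 ≤ 32 := by
    have : Real.exp 3 = Real.exp 1 ^ 3 := by rw [← Real.exp_nat_mul]; norm_num
    rw [this]
    calc Real.exp 1 ^ 3 ≤ 3 ^ 3 := by gcongr; linarith [Real.exp_one_lt_d9]
      _ ≤ 32 := by norm_num
  linarith

lemma cutoff_sq {α : ℝ} (h0 : 0 < α) (h1 : α ≤ 1) : cutoff α ^ 2 = 4 * Real.log (32 / α) :=
  Real.sq_sqrt (by linarith [three_le_log_div h0 h1])

lemma one_le_cutoff {α : ℝ} (h0 : 0 < α) (h1 : α ≤ 1) : 1 ≤ cutoff α :=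
  Real.le_sqrt_of_sq_le (by linarith [three_le_log_div h0 h1])

lemma le_exp_of_cutoff_le {α x : ℝ} (h0 : 0 < α) (h1 : α ≤ 1) (hx : cutoff α ≤ |x|) :
    32 / α ≤ Real.exp (x ^ 2 / 4) := by
  have h : cutoff α ^ 2 ≤ x ^ 2 := by
    rw [← sq_abs x]
    exact pow_le_pow_left₀ (Real.sqrt_nonneg _) hx 2
  rw [cutoff_sq h0 h1] at h
  rw [← Real.log_le_iff_le_exp (by positivity)]
  linarith

lemma phi_le_mul_g {α x : ℝ} (h0 : 0 < α) (h1 : α ≤ 1) (hx : cutoff α ≤ |x|) :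
    phi x ≤ α * g x := by
  have h := le_exp_of_cutoff_le h0 h1 hx
  have h2 := exp_mul_phi_le x
  rw [div_le_iff₀ h0] at h
  have h3 := phi_pos x
  nlinarith [mul_le_mul_of_nonneg_right h h3.le]

/-- The spike weight is at most `φ / (α g) ≤ (32 / α) exp (-x ^ 2 / 4)`. Once `x ^ 2 > 8 log (32 /
α)`, half of the exponent pays for `32 / α` and the other half for `x ^ 2`. -/
lemma one_sub_postWeight_mul_sq_le {α : ℝ} (h0 : 0 < α) (h1 : α ≤ 1) (x : ℝ) :
    (1 - postWeight α x) * x ^ 2 ≤ 8 * Real.log (32 / α) + 8 := by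
  have ha := postWeight_nonneg h0.le h1 x
  have hφ := phi_pos x
  have hg := g_pos x
  have hl := three_le_log_div h0 h1
  rcases le_or_gt (x ^ 2) (8 * Real.log (32 / α)) with hx | hx
  · nlinarith [sq_nonneg x]
  · have h2 : 32 / α ≤ Real.exp (x ^ 2 / 8) := by
      rw [← Real.log_le_iff_le_exp (by positivity)]
      linarith
    have h3 : 1 - postWeight α x ≤ 1 / Real.exp (x ^ 2 / 8) := by
      rw [one_sub_postWeight h0.le h1, div_le_div_iff₀ (mixture_pos h0.le h1 x) (Real.exp_pos _)]
      have h4 := exp_mul_phi_le x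
      have h5 : Real.exp (x ^ 2 / 4) = Real.exp (x ^ 2 / 8) * Real.exp (x ^ 2 / 8) := by
        rw [← Real.exp_add]; congr 1; ring
      have h6 : phi x * Real.exp (x ^ 2 / 8) ≤ α * g x := by
        rw [h5] at h4
        have h7 : 32 / α * (phi x * Real.exp (x ^ 2 / 8)) ≤ 32 * g x := by
          refine le_trans ?_ h4
          calc _ ≤ Real.exp (x ^ 2 / 8) * (phi x * Real.exp (x ^ 2 / 8)) := by gcongr
            _ = _ := by ring
        rw [div_mul_eq_mul_div, div_le_iff₀ h0] at h7
        linarith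
      have h8 : (1 - α) * phi x * Real.exp (x ^ 2 / 8) ≤ phi x * Real.exp (x ^ 2 / 8) := by
        rw [mul_assoc]
        exact mul_le_of_le_one_left (by positivity) (by linarith)
      have h9 : 0 ≤ (1 - α) * phi x := mul_nonneg (by linarith) hφ.le
      linarith
    have h10 := one_add_sq_le_exp (c := 8) (by norm_num) x
    calc (1 - postWeight α x) * x ^ 2 ≤ 1 / Real.exp (x ^ 2 / 8) * (8 * Real.exp (x ^ 2 / 8)) := by
          gcongr
          linarith
      _ = 8 := by field_simp
      _ ≤ _ := by linarith

/-- Being deterministic in `x` and `α`, this bound remains valid at the data-dependent weight. -/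
lemma one_sub_postWeight_mul_signal_sq_le {α : ℝ} (h0 : 0 < α) (h1 : α ≤ 1) (x μ : ℝ) :
    (1 - postWeight α x) * μ ^ 2 ≤ 16 * Real.log (32 / α) + 16 + 2 * (x - μ) ^ 2 := by
  have h := one_sub_postWeight_mul_sq_le h0 h1 x
  have ha := postWeight_nonneg h0.le h1 x
  have ha' : 0 ≤ 1 - postWeight α x := sub_nonneg.2 (postWeight_le_one h0.le h1 x)
  have h2 : μ ^ 2 ≤ 2 * x ^ 2 + 2 * (x - μ) ^ 2 := by nlinarith [sq_nonneg (x + (x - μ))]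
  nlinarith [mul_le_mul_of_nonneg_left h2 ha', sq_nonneg (x - μ)]

/-! ### The score of the marginal likelihood -/

/-- The contribution of an observation `x` to the derivative of the log-marginal likelihood. -/
noncomputable def scoreTerm (α x : ℝ) : ℝ := (g x - phi x) / ((1 - α) * phi x + α * g x)

@[fun_prop]
lemma measurable_scoreTerm (α : ℝ) : Measurable (scoreTerm α) := by
  unfold scoreTerm; fun_prop

lemma scoreTerm_le {α : ℝ} (h0 : 0 < α) (h1 : α ≤ 1) (x : ℝ) : scoreTerm α x ≤ 1 / α := by
  rw [scoreTerm, div_le_div_iff₀ (mixture_pos h0.le h1 x) h0]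
  linarith [phi_pos x]

lemma neg_two_le_scoreTerm {α : ℝ} (h0 : 0 < α) (h1 : α ≤ 1 / 2) (x : ℝ) :
    -2 ≤ scoreTerm α x := by
  rw [scoreTerm, le_div_iff₀ (mixture_pos h0.le (by linarith) x)]
  nlinarith [phi_pos x, g_pos x, mul_pos h0 (g_pos x)]

/-- Beyond the cutoff, `φ ≤ α g`: the numerator is at least `g / 2` and the denominator at most `2 α
g`. -/
lemma le_scoreTerm {α x : ℝ} (h0 : 0 < α) (h1 : α ≤ 1 / 2) (hx : cutoff α ≤ |x|) :
    1 / (4 * α) ≤ scoreTerm α x := by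
  have h := phi_le_mul_g h0 (by linarith) hx
  rw [scoreTerm, div_le_div_iff₀ (by positivity) (mixture_pos h0.le (by linarith) x)]
  nlinarith [phi_pos x, g_pos x, mul_pos h0 (g_pos x), mul_pos h0 (phi_pos x)]

/-- By concavity of the log-marginal likelihood, the sign of the score at `α` tells on which side
of `α` the maximiser lies. -/
lemma mle_sub_mul_score_nonneg {n : ℕ} {αhat : (Fin n → ℝ) → ℝ} (h : IsMarginalMLE αhat)
    {α : ℝ} (hα : α ∈ Set.Icc (alphaMin n) 1) (X : Fin n → ℝ) :
    0 ≤ (αhat X - α) * ∑ i, scoreTerm α (X i) := by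
  have h0 : 0 ≤ α := (alphaMin_pos n).le.trans hα.1
  have hh0 : 0 ≤ αhat X := (alphaMin_pos n).le.trans (h X).1.1
  have hmax : logMarginal α X ≤ logMarginal (αhat X) X := (h X).2 hα
  have key : logMarginal (αhat X) X - logMarginal α X
      ≤ (αhat X - α) * ∑ i, scoreTerm α (X i) := by
    rw [logMarginal, logMarginal, ← Finset.sum_sub_distrib, Finset.mul_sum]
    refine Finset.sum_le_sum fun i _ => ?_
    have hD := mixture_pos h0 hα.2 (X i)
    have hD' := mixture_pos hh0 (h X).1.2 (X i)
    rw [← Real.log_div hD'.ne' hD.ne']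
    -- The mixture is affine in the weight, so `log y ≤ y - 1` at the ratio of the two mixtures is
    -- the tangent-line inequality for the concave log-likelihood.
    refine (Real.log_le_sub_one_of_pos (div_pos hD' hD)).trans_eq ?_
    rw [scoreTerm, mul_div_assoc', eq_div_iff hD.ne', sub_mul, div_mul_cancel₀ _ hD.ne']
    ring
  linarith

/-! ### Gaussian integrals -/

lemma lintegral_gaussianReal_le {f F : ℝ → ℝ} (hf : Measurable f) (hF : Integrable F)
    (h0 : ∀ x, 0 ≤ F x) (h : ∀ x, phi x * f x ≤ F x) :
    ∫⁻ x, ENNReal.ofReal (f x) ∂gaussianReal 0 1 ≤ ENNReal.ofReal (∫ x, F x) := by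
  rw [gaussianReal_of_var_ne_zero 0 one_ne_zero,
    lintegral_withDensity_eq_lintegral_mul _ (measurable_gaussianPDF 0 1) (by fun_prop),
    ofReal_integral_eq_lintegral_ofReal hF (.of_forall h0)]
  refine lintegral_mono fun x => ?_
  simp only [Pi.mul_apply, gaussianPDF]
  rw [← ENNReal.ofReal_mul (gaussianPDFReal_nonneg _ _ _)]
  exact ENNReal.ofReal_le_ofReal (h x)

lemma lintegral_gaussianReal_one_add_sq_sq_le :
    ∫⁻ x, ENNReal.ofReal ((1 + x ^ 2) ^ 2) ∂gaussianReal 0 1 ≤ ENNReal.ofReal 128 :=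
  (lintegral_gaussianReal_le (by fun_prop) integrable_phi_mul_one_add_sq_sq
    (fun x => mul_nonneg (phi_pos x).le (by positivity)) fun _ => le_rfl).trans
    (ENNReal.ofReal_le_ofReal integral_phi_mul_one_add_sq_sq_le)

lemma lintegral_gaussianReal_sub_sq_le (μ : ℝ) :
    ∫⁻ x, ENNReal.ofReal ((x - μ) ^ 2) ∂gaussianReal μ 1 ≤ 1 := by
  have h : gaussianReal μ 1 = (gaussianReal 0 1).map (fun x => x + μ) := by
    rw [gaussianReal_map_add_const, zero_add]
  rw [h, lintegral_map (by fun_prop) (by fun_prop)]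
  simp only [add_sub_cancel_right]
  refine (lintegral_gaussianReal_le (by fun_prop) integrable_phi_mul_sq
    (fun x => mul_nonneg (phi_pos x).le (by positivity)) fun _ => le_rfl).trans ?_
  rw [integral_phi_mul_sq, ENNReal.ofReal_one]

/-- Contribution of a zero coordinate to the posterior risk. -/
lemma lintegral_postWeight_mul_le {α : ℝ} (h0 : 0 < α) (h1 : α ≤ 1 / 2) :
    ∫⁻ x, ENNReal.ofReal (postWeight α x * (1 + x ^ 2)) ∂gaussianReal 0 1
      ≤ ENNReal.ofReal (9 * α * cutoff α) := by
  have hc := one_le_cutoff h0 (by linarith)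
  set ζ := cutoff α with hζ
  have hi1 : Integrable ((Set.Icc (-ζ) ζ).indicator fun _ : ℝ => 4 * α) :=
    (integrable_indicator_iff measurableSet_Icc).2 (integrableOn_const (by simp))
  have hi2 : Integrable fun x : ℝ => α / 8 * Real.exp (-(1 / 8) * x ^ 2) :=
    (integrable_exp_neg_mul_sq (by norm_num)).const_mul _
  refine (lintegral_gaussianReal_le (by fun_prop) (hi1.add hi2) ?_ ?_).trans ?_
  · intro x
    exact add_nonneg (Set.indicator_nonneg (fun _ _ => by positivity) _) (by positivity)
  · intro x
    have hφ := phi_pos x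
    have hg := g_pos x
    have hD := mixture_pos h0.le (by linarith : α ≤ 1) x
    simp only [Pi.add_apply]
    -- Inside the cutoff the integrand is at most `2 α g x (1 + x ^ 2) ≤ 4 α`, over a length `2 ζ`.
    -- Outside, the posterior weight is bounded by `1` and the Gaussian tail yields a factor `α /
    -- 32`.
    by_cases hx : x ∈ Set.Icc (-ζ) ζ
    · rw [Set.indicator_of_mem hx]
      have h2 : phi x * postWeight α x ≤ 2 * α * g x := by
        rw [postWeight, mul_div_assoc', div_le_iff₀ hD]
        have : phi x ≤ 2 * ((1 - α) * phi x + α * g x) := by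
          nlinarith [mul_pos h0 hg]
        nlinarith [mul_le_mul_of_nonneg_left this (mul_pos h0 hg).le]
      have h3 : g x * (1 + x ^ 2) ≤ 2 := by
        have := g_le x
        rwa [le_div_iff₀ (by positivity)] at this
      have h4 : phi x * (postWeight α x * (1 + x ^ 2)) ≤ 4 * α := by
        calc _ = phi x * postWeight α x * (1 + x ^ 2) := by ring
          _ ≤ 2 * α * g x * (1 + x ^ 2) := by gcongr
          _ = 2 * α * (g x * (1 + x ^ 2)) := by ring
          _ ≤ 2 * α * 2 := by gcongr
          _ = _ := by ring
      have : 0 < Real.exp (-(1 / 8) * x ^ 2) := Real.exp_pos _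
      nlinarith
    · rw [Set.indicator_of_notMem hx, zero_add]
      have hx' : ζ ≤ |x| := by
        rw [Set.mem_Icc, ← abs_le, not_le] at hx
        exact hx.le
      have h2 := le_exp_of_cutoff_le h0 (by linarith) hx'
      have h3 := one_add_sq_le_exp (c := 8) (by norm_num) x
      have h4 : Real.exp (-x ^ 2 / 2) * Real.exp (x ^ 2 / 8)
          = Real.exp (-(1 / 8) * x ^ 2) * (Real.exp (x ^ 2 / 4))⁻¹ := by
        rw [← Real.exp_neg, ← Real.exp_add, ← Real.exp_add]; congr 1; ring
      calc phi x * (postWeight α x * (1 + x ^ 2))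
          ≤ Real.exp (-x ^ 2 / 2) / 2 * (1 * (8 * Real.exp (x ^ 2 / 8))) := by
            have := postWeight_nonneg h0.le (by linarith) x
            gcongr
            · exact phi_le x
            · exact postWeight_le_one h0.le (by linarith) x
        _ = 4 * Real.exp (-(1 / 8) * x ^ 2) * (Real.exp (x ^ 2 / 4))⁻¹ := by
            rw [mul_assoc 4, ← h4]; ring
        _ ≤ 4 * Real.exp (-(1 / 8) * x ^ 2) * (32 / α)⁻¹ := by gcongr
        _ = _ := by rw [inv_div]; ring
  · refine ENNReal.ofReal_le_ofReal ?_
    simp only [Pi.add_apply]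
    rw [integral_add hi1 hi2, integral_indicator measurableSet_Icc, setIntegral_const,
      integral_const_mul, integral_gaussian]
    have h5 : √(Real.pi / (1 / 8)) ≤ 8 :=
      Real.sqrt_le_iff.2 ⟨by norm_num, by linarith [Real.pi_lt_four]⟩
    have h6 : (volume.real (Set.Icc (-ζ) ζ)) = 2 * ζ := by
      rw [Real.volume_real_Icc_of_le (by linarith)]; ring
    rw [h6, smul_eq_mul]
    have h7 : α / 8 * √(Real.pi / (1 / 8)) ≤ α / 8 * 8 := by gcongr
    nlinarith [mul_le_mul_of_nonneg_left hc h0.le]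

/-! ### Exponential moment of the score -/

/-- Write `B` for the score term and `D = φ + α (g - φ)` for the mixture, so that `B D = g - φ`. The
linear term of the exponential gives `φ B = (g - φ) - α B (g - φ)`, with `B (g - φ) = B ^ 2 D ≥ 0`.
Since `α ≤ 1 / 3`, the quadratic term takes back at most three quarters of this gain. Beyond the
cutoff the remaining quarter is at least `α g / 64`. -/
lemma phi_mul_exp_scoreTerm_le {α : ℝ} (h0 : 0 < α) (h1 : α ≤ 1 / 3) (x : ℝ) :
    phi x * Real.exp (α / 2 * scoreTerm α x) ≤ phi x + α / 2 * (g x - phi x)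
      - α / 64 * ({y : ℝ | cutoff α ≤ |y|}.indicator g x) := by
  have hφ := phi_pos x
  have hg := g_pos x
  have hD := mixture_pos h0.le (by linarith : α ≤ 1) x
  have hB1 := scoreTerm_le h0 (by linarith : α ≤ 1) x
  have hB2 := neg_two_le_scoreTerm h0 (by linarith : α ≤ 1 / 2) x
  set B := scoreTerm α x with hB
  have hBD : B * ((1 - α) * phi x + α * g x) = g x - phi x := by
    rw [hB, scoreTerm, div_mul_cancel₀ _ hD.ne']
  have hαB : α * B ≤ 1 := by
    calc α * B ≤ α * (1 / α) := by gcongr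
      _ = 1 := by field_simp
  have habs : |α / 2 * B| ≤ 1 := abs_le.2 ⟨by nlinarith, by linarith⟩
  have hexp : Real.exp (α / 2 * B) ≤ 1 + α / 2 * B + (α / 2 * B) ^ 2 := by
    linarith [(abs_le.1 (Real.abs_exp_sub_one_sub_id_le habs)).2]
  have hQ : phi x * B = (g x - phi x) - α * (B * (g x - phi x)) := by
    linear_combination hBD
  have hQ2 : phi x * B ^ 2 ≤ 3 / 2 * (B * (g x - phi x)) := by
    rw [← hBD]
    have : phi x ≤ 3 / 2 * ((1 - α) * phi x + α * g x) := by nlinarith [mul_pos h0 hg]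
    nlinarith [mul_le_mul_of_nonneg_right this (sq_nonneg B)]
  have hmain : phi x * Real.exp (α / 2 * B) ≤ phi x + α / 2 * (g x - phi x)
      - α ^ 2 / 8 * (B * (g x - phi x)) := by
    calc phi x * Real.exp (α / 2 * B) ≤ phi x * (1 + α / 2 * B + (α / 2 * B) ^ 2) := by gcongr
      _ = phi x + α / 2 * (phi x * B) + α ^ 2 / 4 * (phi x * B ^ 2) := by ring
      _ ≤ phi x + α / 2 * (phi x * B) + α ^ 2 / 4 * (3 / 2 * (B * (g x - phi x))) := by gcongr
      _ = _ := by rw [hQ]; ring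
  refine hmain.trans ?_
  by_cases hx : cutoff α ≤ |x|
  · rw [Set.indicator_of_mem (show x ∈ {y : ℝ | cutoff α ≤ |y|} from hx)]
    have h2 := phi_le_mul_g h0 (by linarith) hx
    have h3 := le_scoreTerm h0 (by linarith) hx
    have h4 : g x / 2 ≤ g x - phi x := by nlinarith
    have hB0 : 0 ≤ B := le_trans (by positivity) h3
    have h5 : g x / (8 * α) ≤ B * (g x - phi x) := by
      calc g x / (8 * α) = 1 / (4 * α) * (g x / 2) := by field_simp; norm_num
        _ ≤ _ := by gcongr
    have h6 : α ^ 2 / 8 * (g x / (8 * α)) = α / 64 * g x := by field_simp; norm_num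
    have h7 : α ^ 2 / 8 * (g x / (8 * α)) ≤ α ^ 2 / 8 * (B * (g x - phi x)) := by gcongr
    linarith
  · rw [Set.indicator_of_notMem (show x ∉ {y : ℝ | cutoff α ≤ |y|} from hx)]
    have : 0 ≤ B * (g x - phi x) := by
      rw [← hBD]
      nlinarith [mul_nonneg (sq_nonneg B) hD.le]
    nlinarith [mul_nonneg (sq_nonneg α) this]

/-- The interval `[t, 2t]` alone suffices: on it `g ≥ 1 / (16 (1 + 4 t ^ 2)) ≥ 1 / (80 t ^ 2)`. -/
lemma le_setIntegral_g {t : ℝ} (ht : 1 ≤ t) : 1 / (80 * t) ≤ ∫ x in {y : ℝ | t ≤ |y|}, g x := by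
  have hsub : Set.Icc t (2 * t) ⊆ {y : ℝ | t ≤ |y|} := fun y hy => hy.1.trans (le_abs_self y)
  calc 1 / (80 * t) ≤ ∫ x in Set.Icc t (2 * t), 1 / (80 * t ^ 2) := by
        rw [setIntegral_const, Real.volume_real_Icc_of_le (by linarith), smul_eq_mul]
        refine le_of_eq ?_
        field_simp
        ring
    _ ≤ ∫ x in Set.Icc t (2 * t), g x := by
        refine setIntegral_mono_on (integrableOn_const (by simp)) integrable_g.integrableOn
          measurableSet_Icc fun x hx => ?_
        refine le_trans ?_ (le_g x)
        refine one_div_le_one_div_of_le (by positivity) ?_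
        nlinarith [hx.1, hx.2]
    _ ≤ _ := setIntegral_mono_set integrable_g.integrableOn
        (.of_forall fun x => (g_pos x).le) hsub.eventuallyLE

/-- The term `g - φ` integrates to zero, so only the tail gain survives; `5120 = 64 * 80`. -/
lemma lintegral_exp_scoreTerm_le {α : ℝ} (h0 : 0 < α) (h1 : α ≤ 1 / 3) :
    ∫⁻ x, ENNReal.ofReal (Real.exp (α / 2 * scoreTerm α x)) ∂gaussianReal 0 1
      ≤ ENNReal.ofReal (Real.exp (-(α / (5120 * cutoff α)))) := by
  have hc := one_le_cutoff h0 (by linarith)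
  have hms : MeasurableSet {y : ℝ | cutoff α ≤ |y|} := measurableSet_le (by fun_prop) (by fun_prop)
  have hi0 : Integrable fun x => α / 2 * (g x - phi x) :=
    (integrable_g.sub integrable_phi).const_mul _
  have hi1 : Integrable fun x => phi x + α / 2 * (g x - phi x) := integrable_phi.add hi0
  have hi2 : Integrable fun x => α / 64 * ({y : ℝ | cutoff α ≤ |y|}.indicator g x) :=
    (integrable_g.indicator hms).const_mul _
  refine (lintegral_gaussianReal_le (by fun_prop) (hi1.sub hi2) ?_
    (phi_mul_exp_scoreTerm_le h0 h1)).trans ?_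
  · intro x
    exact (mul_nonneg (phi_pos x).le (Real.exp_nonneg _)).trans (phi_mul_exp_scoreTerm_le h0 h1 x)
  · refine ENNReal.ofReal_le_ofReal ?_
    simp only [Pi.sub_apply]
    rw [integral_sub hi1 hi2, integral_const_mul, integral_indicator hms,
      integral_add integrable_phi hi0,
      integral_const_mul, integral_sub integrable_g integrable_phi, integral_phi, integral_g]
    have h2 := le_setIntegral_g hc
    have h3 : α / (5120 * cutoff α) = α / 64 * (1 / (80 * cutoff α)) := by field_simp; norm_num
    have h4 := Real.add_one_le_exp (-(α / (5120 * cutoff α)))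
    have h5 : α / 64 * (1 / (80 * cutoff α)) ≤ α / 64 * ∫ x in {y : ℝ | cutoff α ≤ |y|}, g x := by
      gcongr
    linarith

/-! ### Product formulas under the law of the data -/

instance isProbabilityMeasure_dataLaw {n : ℕ} (θ : Fin n → ℝ) :
    IsProbabilityMeasure (dataLaw θ) := by
  unfold dataLaw; infer_instance

lemma lintegral_dataLaw_eval {n : ℕ} (θ : Fin n → ℝ) (i : Fin n) {f : ℝ → ENNReal}
    (hf : Measurable f) : ∫⁻ X, f (X i) ∂dataLaw θ = ∫⁻ x, f x ∂gaussianReal (θ i) 1 :=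
  lintegral_pi_eval (fun i => gaussianReal (θ i) 1) i hf

lemma lintegral_dataLaw_prod {n : ℕ} (θ : Fin n → ℝ) (s : Finset (Fin n))
    {f : Fin n → ℝ → ENNReal} (hf : ∀ i, Measurable (f i)) :
    ∫⁻ X, ∏ i ∈ s, f i (X i) ∂dataLaw θ = ∏ i ∈ s, ∫⁻ x, f i x ∂gaussianReal (θ i) 1 := by
  have hind : iIndepFun (fun i (X : Fin n → ℝ) => f i (X i)) (dataLaw θ) :=
    iIndepFun_pi (μ := fun i => gaussianReal (θ i) 1) fun i => (hf i).aemeasurable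
  rw [lintegral_prod_eq_prod_lintegral_of_indepFun s _ hind
    fun i => (hf i).comp (measurable_pi_apply i)]
  exact Finset.prod_congr rfl fun i _ => lintegral_dataLaw_eval θ i (hf i)

/-- Chernoff bound for sums of functions of the coordinates. -/
lemma dataLaw_sum_le {n : ℕ} (θ : Fin n → ℝ) (s : Finset (Fin n)) {h : Fin n → ℝ → ℝ}
    (hh : ∀ i, Measurable (h i)) {b : Fin n → ℝ}
    (hb : ∀ i ∈ s, ∫⁻ x, ENNReal.ofReal (Real.exp (h i x)) ∂gaussianReal (θ i) 1
      ≤ ENNReal.ofReal (Real.exp (b i))) (t : ℝ) :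
    dataLaw θ {X | t ≤ ∑ i ∈ s, h i (X i)} ≤ ENNReal.ofReal (Real.exp (∑ i ∈ s, b i - t)) := by
  have hms : MeasurableSet {X : Fin n → ℝ | t ≤ ∑ i ∈ s, h i (X i)} :=
    measurableSet_le (by fun_prop) (by fun_prop)
  rw [← lintegral_indicator_one hms]
  calc _ ≤ ∫⁻ X, ENNReal.ofReal (Real.exp (-t)) *
        ∏ i ∈ s, ENNReal.ofReal (Real.exp (h i (X i))) ∂dataLaw θ := by
        refine lintegral_mono fun X => ?_
        rw [← ENNReal.ofReal_prod_of_nonneg fun i _ => Real.exp_nonneg _,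
          ← ENNReal.ofReal_mul (Real.exp_nonneg _), ← Real.exp_sum, ← Real.exp_add]
        by_cases hX : t ≤ ∑ i ∈ s, h i (X i)
        · rw [Set.indicator_of_mem (by exact hX), Pi.one_apply, ENNReal.one_le_ofReal,
            Real.one_le_exp_iff]
          linarith
        · rw [Set.indicator_of_notMem (by exact hX)]
          exact zero_le
    _ = ENNReal.ofReal (Real.exp (-t)) *
        ∏ i ∈ s, ∫⁻ x, ENNReal.ofReal (Real.exp (h i x)) ∂gaussianReal (θ i) 1 := by
        rw [lintegral_const_mul _ (by fun_prop), lintegral_dataLaw_prod θ s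
          (f := fun i x => ENNReal.ofReal (Real.exp (h i x))) fun i => by fun_prop]
    _ ≤ ENNReal.ofReal (Real.exp (-t)) * ∏ i ∈ s, ENNReal.ofReal (Real.exp (b i)) := by
        gcongr with i hi
        exact hb i hi
    _ = _ := by
        rw [← ENNReal.ofReal_prod_of_nonneg fun i _ => Real.exp_nonneg _,
          ← ENNReal.ofReal_mul (Real.exp_nonneg _), ← Real.exp_sum, ← Real.exp_add]
        congr 2; ring

/-! ### Splitting a finite family at a self-consistent level -/

/-- In decreasing order, the `j`-th largest value is at most `t j` for every `j > k`. The induction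
peels off one element below the level `t (m + 1)` at a time. -/
lemma exists_subset_sum_sdiff_le {ι : Type*} [DecidableEq ι] (f : ι → ℝ) (t : ℕ → ℝ) {k m : ℕ}
    (hkm : k ≤ m) : ∀ I : Finset ι, I.card = m →
      (∀ j, k < j → j ≤ m → (I.filter fun i => t j < f i).card < j) →
      ∃ L ⊆ I, L.card ≤ k ∧ ∑ i ∈ I \ L, f i ≤ ∑ j ∈ Finset.Ioc k m, t j := by
  induction m, hkm using Nat.le_induction with
  | base => exact fun I hI _ => ⟨I, subset_rfl, hI.le, by simp⟩
  | succ m hkm ih =>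
    intro I hI h
    obtain ⟨i, hi, hfi⟩ : ∃ i ∈ I, f i ≤ t (m + 1) := by
      by_contra! hcon
      have := h (m + 1) (by lia) le_rfl
      rw [Finset.filter_true_of_mem hcon, hI] at this
      exact this.false
    obtain ⟨L, hL, hLk, hsum⟩ := ih (I.erase i) (by rw [Finset.card_erase_of_mem hi, hI]; rfl)
      fun j hj hjm => lt_of_le_of_lt
        (Finset.card_le_card (Finset.filter_subset_filter _ (Finset.erase_subset i I)))
        (h j hj (by lia))
    refine ⟨L, hL.trans (Finset.erase_subset i I), hLk, ?_⟩
    have hiL : i ∉ L := fun hi' => (Finset.notMem_erase i I) (hL hi')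
    have hins : I \ L = insert i (I.erase i \ L) := by
      rw [← Finset.insert_sdiff_of_notMem _ hiL, Finset.insert_erase hi]
    rw [hins, Finset.sum_insert (by simp), Finset.sum_Ioc_succ_top hkm]
    linarith

/-- Given levels `t j`, there is a `k` such that `k` of the values `f i` exceed `t k`, while all
but `k` of them sum up to at most `∑_{j > k} t j`. -/
lemma exists_large_subset {ι : Type*} [DecidableEq ι] (f : ι → ℝ) (t : ℕ → ℝ) (I : Finset ι) :
    ∃ k ≤ I.card, (∃ K ⊆ I, K.card = k ∧ ∀ i ∈ K, t k < f i) ∧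
      ∃ L ⊆ I, L.card ≤ k ∧ ∑ i ∈ I \ L, f i ≤ ∑ j ∈ Finset.Ioc k I.card, t j := by
  classical
  let P : ℕ → Prop := fun k => k ≤ (I.filter fun i => t k < f i).card
  -- `P 0` holds trivially, so the greatest index satisfies `P`; by maximality, for each larger `j`
  -- fewer than `j` values exceed `t j`.
  refine ⟨Nat.findGreatest P I.card, Nat.findGreatest_le _, ?_, ?_⟩
  · have hP : P (Nat.findGreatest P I.card) :=
      Nat.findGreatest_spec (P := P) (Nat.zero_le _) (Nat.zero_le _)
    obtain ⟨K, hK, hcard⟩ := Finset.exists_subset_card_eq hP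
    exact ⟨K, hK.trans (Finset.filter_subset _ _), hcard, fun i hi => (Finset.mem_filter.1 (hK hi)).2⟩
  · exact exists_subset_sum_sdiff_le f t (Nat.findGreatest_le _) I rfl fun j hj hjm =>
      not_le.1 (Nat.findGreatest_is_greatest (P := P) hj hjm)

/-- The sum is `log (s ^ m / m!)`, and `s ^ m / m!` is at most `exp s`. -/
lemma sum_log_div_le {s : ℝ} (hs : 0 < s) (m : ℕ) :
    ∑ j ∈ Finset.Icc 1 m, Real.log (s / j) ≤ s := by
  rw [← Real.log_prod fun j hj => by
    have : 1 ≤ j := (Finset.mem_Icc.1 hj).1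
    positivity]
  rw [Finset.prod_div_distrib, Finset.prod_const, Nat.card_Icc, Nat.add_sub_cancel,
    ← Nat.cast_prod, ← Finset.Ico_add_one_right_eq_Icc, Finset.prod_Ico_id_eq_factorial,
    Real.log_le_iff_le_exp (by positivity)]
  exact Real.pow_div_factorial_le_exp _ hs.le m

lemma log_1024_le : Real.log 1024 ≤ 7 := by
  have : (1024 : ℝ) = 2 ^ 10 := by norm_num
  rw [this, Real.log_pow]
  push_cast
  linarith [Real.log_two_lt_d9]

lemma log_mul_div_eq {n s j : ℝ} (hn : 0 < n) (hs : 0 < s) (hj : 0 < j) :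
    Real.log (1024 * n / j) = Real.log 1024 + Real.log (n / s) + Real.log (s / j) := by
  rw [← Real.log_mul (by norm_num) (by positivity), ← Real.log_mul (by positivity) (by positivity)]
  congr 1
  field_simp

lemma sum_log_le {n s : ℝ} (hn : 0 < n) (hs : 0 < s) (hsn : 1 ≤ Real.log (n / s)) {k m : ℕ}
    (hm : m ≤ s) :
    ∑ j ∈ Finset.Ioc k m, 16 * Real.log (1024 * n / j) ≤ 144 * (s * Real.log (n / s)) := by
  have hsub : Finset.Ioc k m ⊆ Finset.Icc 1 m := fun j hj => by
    rw [Finset.mem_Ioc] at hj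
    exact Finset.mem_Icc.2 ⟨by lia, hj.2⟩
  have heq : ∀ j ∈ Finset.Icc 1 m, 16 * Real.log (1024 * n / j) =
      16 * (Real.log 1024 + Real.log (n / s)) + 16 * Real.log (s / j) := by
    intro j hj
    have : 1 ≤ j := (Finset.mem_Icc.1 hj).1
    rw [log_mul_div_eq hn hs (by positivity)]
    ring
  have h1024 : 0 ≤ Real.log 1024 := Real.log_nonneg (by norm_num)
  calc _ ≤ ∑ j ∈ Finset.Icc 1 m, 16 * Real.log (1024 * n / j) := by
        refine Finset.sum_le_sum_of_subset_of_nonneg hsub fun j hj _ => ?_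
        rw [heq j hj]
        have hj' := Finset.mem_Icc.1 hj
        have : 0 ≤ Real.log (s / j) := by
          refine Real.log_nonneg ?_
          rw [one_le_div (by exact_mod_cast hj'.1)]
          exact le_trans (by exact_mod_cast hj'.2) hm
        linarith
    _ = m * (16 * (Real.log 1024 + Real.log (n / s)))
        + 16 * ∑ j ∈ Finset.Icc 1 m, Real.log (s / j) := by
        rw [Finset.sum_congr rfl heq, Finset.sum_add_distrib, Finset.sum_const, Nat.card_Icc,
          Nat.add_sub_cancel, nsmul_eq_mul, Finset.mul_sum]
    _ ≤ s * (16 * (7 * Real.log (n / s) + Real.log (n / s))) + 16 * (s * Real.log (n / s)) := by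
        have h1 := sum_log_div_le hs m
        have h2 : s ≤ s * Real.log (n / s) := le_mul_of_one_le_right hs.le hsn
        have h3 : Real.log 1024 ≤ 7 * Real.log (n / s) := by linarith [log_1024_le]
        gcongr
        exact h1.trans h2
    _ = _ := by ring

lemma mul_log_le {n s k : ℝ} (hn : 0 < n) (hs : 0 < s) (hsn : 1 ≤ Real.log (n / s))
    (hk : 0 < k) (hks : k ≤ s) :
    k * Real.log (1024 * n / k) ≤ 9 * (s * Real.log (n / s)) := by
  rw [log_mul_div_eq hn hs hk]
  have h1 : k * Real.log (s / k) ≤ s := by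
    have := Real.log_le_sub_one_of_pos (div_pos hs hk)
    calc k * Real.log (s / k) ≤ k * (s / k) := by
          gcongr
          linarith
      _ = s := by field_simp
  have h2 : s ≤ s * Real.log (n / s) := le_mul_of_one_le_right hs.le hsn
  have h3 : k * (Real.log 1024 + Real.log (n / s)) ≤ s * (8 * Real.log (n / s)) := by
    gcongr
    linarith [log_1024_le]
  linarith

/-! ### Lower bound on the estimated weight -/

/-- The indicator that the noise of an observation `x` with mean `μ` exceeds `t`. -/
noncomputable def noiseExceeds (t μ x : ℝ) : ℝ := {y : ℝ | t < |y - μ|}.indicator 1 x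

@[fun_prop]
lemma measurable_noiseExceeds (t μ : ℝ) : Measurable (noiseExceeds t μ) :=
  measurable_one.indicator (measurableSet_lt (by fun_prop) (by fun_prop))

lemma noiseExceeds_of_lt {t μ x : ℝ} (h : t < |x - μ|) : noiseExceeds t μ x = 1 :=
  Set.indicator_of_mem (s := {y : ℝ | t < |y - μ|}) h _

lemma noiseExceeds_of_le {t μ x : ℝ} (h : |x - μ| ≤ t) : noiseExceeds t μ x = 0 :=
  Set.indicator_of_notMem (s := {y : ℝ | t < |y - μ|}) (not_lt.2 h) _

/-- As `t ^ 2 ≥ 8`, the value `e < 3` at an exceedance lies below `1 + (x - μ) ^ 2 / 4`, so unit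
variance gives `5 / 4 ≤ exp (1 / 4)`. -/
lemma lintegral_exp_noiseExceeds_le {t : ℝ} (ht : 8 ≤ t ^ 2) (ht0 : 0 ≤ t) (μ : ℝ) :
    ∫⁻ x, ENNReal.ofReal (Real.exp (noiseExceeds t μ x)) ∂gaussianReal μ 1
      ≤ ENNReal.ofReal (Real.exp (1 / 4)) := by
  have key : ∀ x, Real.exp (noiseExceeds t μ x) ≤ 1 + 1 / 4 * (x - μ) ^ 2 := by
    intro x
    rcases le_or_gt |x - μ| t with h | h
    · rw [noiseExceeds_of_le h, Real.exp_zero]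
      nlinarith [sq_nonneg (x - μ)]
    · rw [noiseExceeds_of_lt h]
      have : t ^ 2 ≤ (x - μ) ^ 2 := by
        rw [← sq_abs (x - μ)]
        exact pow_le_pow_left₀ ht0 h.le 2
      linarith [Real.exp_one_lt_d9]
  calc _ ≤ ∫⁻ x, (1 + ENNReal.ofReal (1 / 4) * ENNReal.ofReal ((x - μ) ^ 2)) ∂gaussianReal μ 1 := by
        refine lintegral_mono fun x => ?_
        rw [← ENNReal.ofReal_mul (by norm_num), ← ENNReal.ofReal_one,
          ← ENNReal.ofReal_add zero_le_one (by positivity)]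
        exact ENNReal.ofReal_le_ofReal (key x)
    _ ≤ 1 + ENNReal.ofReal (1 / 4) * 1 := by
        rw [lintegral_add_left (by fun_prop), lintegral_const, measure_univ, mul_one,
          lintegral_const_mul _ (by fun_prop)]
        gcongr
        exact lintegral_gaussianReal_sub_sq_le μ
    _ = ENNReal.ofReal (1 + 1 / 4) := by
        rw [mul_one, ← ENNReal.ofReal_one, ← ENNReal.ofReal_add zero_le_one (by norm_num)]
    _ ≤ _ := ENNReal.ofReal_le_ofReal (by linarith [Real.add_one_le_exp (1 / 4 : ℝ)])

/-- The event that at least half of the coordinates in `K` have a noise larger than `t`. -/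
def noisySet {n : ℕ} (θ : Fin n → ℝ) (K : Finset (Fin n)) (t : ℝ) : Set (Fin n → ℝ) :=
  {X | (K.card : ℝ) / 2 ≤ ∑ i ∈ K, noiseExceeds t (θ i) (X i)}

lemma measurableSet_noisySet {n : ℕ} (θ : Fin n → ℝ) (K : Finset (Fin n)) (t : ℝ) :
    MeasurableSet (noisySet θ K t) :=
  measurableSet_le (by fun_prop) (by fun_prop)

lemma dataLaw_noisySet_le {n : ℕ} (θ : Fin n → ℝ) (K : Finset (Fin n)) {t : ℝ}
    (ht : 8 ≤ t ^ 2) (ht0 : 0 ≤ t) :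
    dataLaw θ (noisySet θ K t) ≤ ENNReal.ofReal (Real.exp (-(K.card / 4))) := by
  refine (dataLaw_sum_le θ K (h := fun i => noiseExceeds t (θ i)) (fun i => by fun_prop)
    (b := fun _ => 1 / 4) (fun i _ => lintegral_exp_noiseExceeds_le ht ht0 (θ i)) _).trans_eq ?_
  rw [Finset.sum_const, nsmul_eq_mul]
  congr 2; ring

/-- If many coordinates have a large mean, the estimated weight is not too small. -/
lemma le_mle_of_notMem_noisySet {n : ℕ} {αhat : (Fin n → ℝ) → ℝ} (h : IsMarginalMLE αhat)
    {θ X : Fin n → ℝ} {K : Finset (Fin n)} (hK : 0 < K.card) {α : ℝ}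
    (hα : α = K.card / (32 * n)) (hθ : ∀ i ∈ K, 2 * cutoff α ≤ |θ i|)
    (hX : X ∉ noisySet θ K (cutoff α)) : α ≤ αhat X := by
  have hKn : K.card ≤ n := by simpa using Finset.card_le_univ K
  have hn : (0 : ℝ) < n := by exact_mod_cast hK.trans_le hKn
  have hK' : (0 : ℝ) < K.card := by exact_mod_cast hK
  have h0 : 0 < α := by rw [hα]; positivity
  have h1 : α ≤ 1 / 2 := by
    rw [hα, div_le_iff₀ (by positivity)]
    have : (K.card : ℝ) ≤ n := by exact_mod_cast hKn
    linarith
  rcases le_total α (alphaMin n) with hle | hle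
  · exact hle.trans (h X).1.1
  have hsgn := mle_sub_mul_score_nonneg h ⟨hle, by linarith⟩ X
  have hpos : 0 < ∑ i, scoreTerm α (X i) := by
    have hX' : ∑ i ∈ K, noiseExceeds (cutoff α) (θ i) (X i) < (K.card : ℝ) / 2 := not_le.1 hX
    -- Adding `2` makes every score term nonnegative, so coordinates outside `K` can be dropped.
    -- Over half of `K` contributes `1 / (4 α)` each, in total at least `4 n`, against the `2 n`
    -- added.
    have hterm : ∀ i ∈ K, (1 - noiseExceeds (cutoff α) (θ i) (X i)) * (1 / (4 * α))
        ≤ scoreTerm α (X i) + 2 := by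
      intro i hi
      have h2 := neg_two_le_scoreTerm h0 h1 (X i)
      rcases le_or_gt |X i - θ i| (cutoff α) with hb | hb
      · rw [noiseExceeds_of_le hb, sub_zero, one_mul]
        have h3 : cutoff α ≤ |X i| := by
          have := abs_sub_abs_le_abs_sub (θ i) (X i)
          rw [abs_sub_comm] at this
          linarith [hθ i hi]
        linarith [le_scoreTerm h0 h1 h3]
      · rw [noiseExceeds_of_lt hb, sub_self, zero_mul]
        linarith
    have hsum : ∑ i ∈ K, (1 - noiseExceeds (cutoff α) (θ i) (X i)) * (1 / (4 * α))
        ≤ ∑ i, (scoreTerm α (X i) + 2) :=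
      (Finset.sum_le_sum hterm).trans (Finset.sum_le_sum_of_subset_of_nonneg
        (Finset.subset_univ K) fun i _ _ => by linarith [neg_two_le_scoreTerm h0 h1 (X i)])
    rw [← Finset.sum_mul, Finset.sum_sub_distrib, Finset.sum_const, nsmul_eq_mul, mul_one,
      Finset.sum_add_distrib, Finset.sum_const, Finset.card_univ, Fintype.card_fin,
      nsmul_eq_mul] at hsum
    have h4 : (K.card : ℝ) / 2 * (1 / (4 * α)) = 4 * n := by
      rw [hα]; field_simp; norm_num
    have h5 : (K.card : ℝ) / 2 * (1 / (4 * α))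
        ≤ (K.card - ∑ i ∈ K, noiseExceeds (cutoff α) (θ i) (X i)) * (1 / (4 * α)) := by
      gcongr
      linarith
    linarith
  by_contra hlt
  exact absurd hsgn (not_le.2 (mul_neg_of_neg_of_pos (by linarith) hpos))

/-! ### Upper bound on the estimated weight -/

/-- The event that the score at `α` is nonnegative. -/
def scoreNonnegSet (n : ℕ) (α : ℝ) : Set (Fin n → ℝ) := {X | 0 ≤ ∑ i, scoreTerm α (X i)}

lemma measurableSet_scoreNonnegSet (n : ℕ) (α : ℝ) : MeasurableSet (scoreNonnegSet n α) :=
  measurableSet_le (by fun_prop) (by fun_prop)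

lemma mle_le_of_notMem_scoreNonnegSet {n : ℕ} {αhat : (Fin n → ℝ) → ℝ} (h : IsMarginalMLE αhat)
    {α : ℝ} (hα : α ∈ Set.Icc (alphaMin n) 1) {X : Fin n → ℝ} (hX : X ∉ scoreNonnegSet n α) :
    αhat X ≤ α := by
  have hsgn := mle_sub_mul_score_nonneg h hα X
  have hneg : ∑ i, scoreTerm α (X i) < 0 := not_le.1 hX
  by_contra hlt
  exact absurd hsgn (not_le.2 (mul_neg_of_pos_of_neg (by linarith) hneg))

/-- Chernoff with tilt `α / 2`: a nonzero coordinate, whatever its mean, contributes at most `exp (1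
/ 2)` because `α` times its score is at most `1`. -/
lemma dataLaw_scoreNonnegSet_le {n : ℕ} (θ : Fin n → ℝ) {α : ℝ} (h0 : 0 < α) (h1 : α ≤ 1 / 3) :
    dataLaw θ (scoreNonnegSet n α) ≤ ENNReal.ofReal (Real.exp
      ((Finset.univ.filter fun i => θ i ≠ 0).card / 2
        - (n - (Finset.univ.filter fun i => θ i ≠ 0).card) * (α / (5120 * cutoff α)))) := by
  set m := (Finset.univ.filter fun i => θ i ≠ 0).card with hm
  have hset : scoreNonnegSet n α = {X | 0 ≤ ∑ i, α / 2 * scoreTerm α (X i)} := by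
    ext X
    simp only [scoreNonnegSet, Set.mem_ofPred_eq, ← Finset.mul_sum]
    exact (mul_nonneg_iff_of_pos_left (by positivity)).symm
  rw [hset]
  refine (dataLaw_sum_le θ Finset.univ (h := fun _ x => α / 2 * scoreTerm α x)
    (fun i => by fun_prop) (b := fun i => if θ i ≠ 0 then 1 / 2 else -(α / (5120 * cutoff α)))
    (fun i _ => ?_) 0).trans_eq ?_
  · by_cases hi : θ i = 0
    · simp only [hi, ne_eq, not_true_eq_false, if_false]
      exact lintegral_exp_scoreTerm_le h0 h1
    · simp only [ne_eq, hi, not_false_eq_true, if_true]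
      calc _ ≤ ∫⁻ _, ENNReal.ofReal (Real.exp (1 / 2)) ∂gaussianReal (θ i) 1 := by
            refine lintegral_mono fun x => ENNReal.ofReal_le_ofReal (Real.exp_le_exp.2 ?_)
            calc α / 2 * scoreTerm α x ≤ α / 2 * (1 / α) := by
                  gcongr
                  exact scoreTerm_le h0 (by linarith) x
              _ = 1 / 2 := by field_simp
        _ = _ := by rw [lintegral_const, measure_univ, mul_one]
  · have hc : ((Finset.univ.filter fun i => ¬ θ i ≠ 0).card : ℝ) = n - m := by
      rw [eq_sub_iff_add_eq', hm]
      have := Finset.card_filter_add_card_filter_not (s := Finset.univ) (fun i => θ i ≠ 0)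
      rw [Finset.card_univ, Fintype.card_fin] at this
      exact_mod_cast this
    rw [Finset.sum_ite, Finset.sum_const, Finset.sum_const, nsmul_eq_mul, nsmul_eq_mul, hc, ← hm]
    congr 2; ring

/-! ### The risk bound -/

/-- An upper bound on the estimated weight, up to an event of small probability. -/
noncomputable def upperWeight (n : ℕ) (s : ℝ) : ℝ := 20480 * (s / n) * √(Real.log (n / s))

lemma one_le_log_div {n s : ℝ} (hs : 0 < s) (hsn : s ≤ 1 / 10 ^ 10 * n) :
    1 ≤ Real.log (n / s) := by
  have hn : 0 < n := by linarith
  rw [Real.le_log_iff_exp_le (by positivity), le_div_iff₀ hs]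
  nlinarith [Real.exp_one_lt_d9]

lemma upperWeight_pos {n : ℕ} {s : ℝ} (hs : 0 < s) (hsn : s ≤ 1 / 10 ^ 10 * n) :
    0 < upperWeight n s := by
  have hn : (0 : ℝ) < n := by linarith
  have hL := one_le_log_div hs hsn
  unfold upperWeight
  positivity

lemma upperWeight_le {n : ℕ} {s : ℝ} (hs : 0 < s) (hsn : s ≤ 1 / 10 ^ 10 * n) :
    upperWeight n s ≤ 1 / 3 := by
  have hn : (0 : ℝ) < n := by linarith
  have hL := one_le_log_div hs hsn
  -- From `log y ≤ y`, the left side is at most `√(s / n)`; this is where the smallness of `s / n`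
  -- is spent.
  have h1 : s / n * √(Real.log (n / s)) ≤ 1 / 10 ^ 5 := by
    have h2 : Real.log (n / s) ≤ n / s := by
      linarith [Real.log_le_sub_one_of_pos (div_pos hn hs)]
    have h3 : (s / n * √(Real.log (n / s))) ^ 2 ≤ (1 / 10 ^ 5) ^ 2 := by
      rw [mul_pow, Real.sq_sqrt (by linarith)]
      calc (s / n) ^ 2 * Real.log (n / s) ≤ (s / n) ^ 2 * (n / s) := by gcongr
        _ = s / n := by field_simp
        _ ≤ (1 / 10 ^ 5) ^ 2 := by rw [div_le_iff₀ hn]; linarith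
    exact le_of_sq_le_sq h3 (by norm_num)
  unfold upperWeight
  rw [mul_assoc]
  linarith

lemma cutoff_upperWeight_le {n : ℕ} {s : ℝ} (hs : 0 < s) (hsn : s ≤ 1 / 10 ^ 10 * n) :
    cutoff (upperWeight n s) ≤ 2 * √(Real.log (n / s)) := by
  have hn : (0 : ℝ) < n := by linarith
  have hL := one_le_log_div hs hsn
  have hA := upperWeight_pos hs hsn
  have hq : 1 ≤ √(Real.log (n / s)) := Real.one_le_sqrt.2 hL
  have h1 : 32 / upperWeight n s ≤ n / s := by
    rw [div_le_div_iff₀ hA hs, upperWeight]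
    have : (n : ℝ) * (20480 * (s / n) * √(Real.log (n / s)))
        = 20480 * s * √(Real.log (n / s)) := by field_simp
    rw [this]
    nlinarith
  rw [cutoff, Real.sqrt_mul (by norm_num), show √(4 : ℝ) = 2 by
    rw [show (4 : ℝ) = 2 ^ 2 by norm_num, Real.sqrt_sq (by norm_num)]]
  gcongr

/-- The score can be compared with the estimator only at weights in `[α_n, 1]`, so `s` must be large
enough for this weight to be admissible. -/
lemma alphaMin_le_upperWeight {n : ℕ} {s : ℝ} (hlog : 1 ≤ Real.log n)
    (hlarge : 48 * Real.log n ≤ n) (hs : 4 * Real.log n ^ 2 ≤ s) (hsn : s ≤ 1 / 10 ^ 10 * n) :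
    alphaMin n ≤ upperWeight n s := by
  have hs0 : 0 < s := by nlinarith
  have hn : (0 : ℝ) < n := by linarith
  have hL := one_le_log_div hs0 hsn
  have hq : 1 ≤ √(Real.log (n / s)) := Real.one_le_sqrt.2 hL
  refine (alphaMin_le (by exact_mod_cast hn) hlog hlarge).trans ?_
  calc 48 * Real.log n / n ≤ 20480 * s / n :=
        div_le_div_of_nonneg_right (by nlinarith) hn.le
    _ = 20480 * (s / n) * 1 := by ring
    _ ≤ _ := by unfold upperWeight; gcongr

lemma dataLaw_scoreNonnegSet_upperWeight_le {n : ℕ} {s : ℝ} (hlog : 1 ≤ Real.log n)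
    (hs : 4 * Real.log n ^ 2 ≤ s) (hsn : s ≤ 1 / 10 ^ 10 * n) {θ : Fin n → ℝ}
    (hθ : ((Finset.univ.filter fun i => θ i ≠ 0).card : ℝ) ≤ s) :
    dataLaw θ (scoreNonnegSet n (upperWeight n s)) ≤ ENNReal.ofReal (1 / n ^ 2) := by
  have hs0 : 0 < s := by nlinarith
  have hn : (0 : ℝ) < n := by linarith
  have hL := one_le_log_div hs0 hsn
  have hA := upperWeight_pos hs0 hsn
  have hA3 := upperWeight_le hs0 hsn
  have hc := one_le_cutoff hA (by linarith)
  have hq : 1 ≤ √(Real.log (n / s)) := Real.one_le_sqrt.2 hL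
  refine (dataLaw_scoreNonnegSet_le θ hA hA3).trans (ENNReal.ofReal_le_ofReal ?_)
  set m : ℝ := ((Finset.univ.filter fun i => θ i ≠ 0).card : ℝ) with hm
  -- The constant `20480 = 4 * 5120` makes the zero coordinates contribute at least `s`, against at
  -- most `s / 2` from the others; the excess `s / 2` is at least `2 log n`.
  have h1 : s ≤ (n - m) * (upperWeight n s / (5120 * cutoff (upperWeight n s))) := by
    calc s = n / 2 * (upperWeight n s / (5120 * (2 * √(Real.log (n / s))))) := by
          rw [upperWeight]; field_simp; norm_num
      _ ≤ n / 2 * (upperWeight n s / (5120 * cutoff (upperWeight n s))) := by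
          gcongr
          exact cutoff_upperWeight_le hs0 hsn
      _ ≤ _ := by
          gcongr
          linarith
  have h2 : (1 : ℝ) / n ^ 2 = Real.exp (-(2 * Real.log n)) := by
    rw [Real.exp_neg, two_mul, Real.exp_add, Real.exp_log hn]
    field_simp
  rw [h2, Real.exp_le_exp]
  nlinarith

/-- The contribution of a zero coordinate, when the weight `α` is at most `A` except if `F`
holds. -/
lemma postWeight_mul_le {α A n : ℝ} (hα : 0 ≤ α) (hα1 : α ≤ 1) (hA : 0 ≤ A) (hA1 : A ≤ 1)
    (hn : 0 < n) {F : Prop} [Decidable F] (h : ¬ F → α ≤ A) (x : ℝ) :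
    postWeight α x * (2816 + 2 * x ^ 2) ≤ 2816 * (postWeight A x * (1 + x ^ 2))
      + 2816 / n * (1 + x ^ 2) ^ 2 + if F then 2816 * n else 0 := by
  have h1 : postWeight α x * (2816 + 2 * x ^ 2) ≤ 2816 * (postWeight α x * (1 + x ^ 2)) := by
    nlinarith [mul_nonneg (postWeight_nonneg hα hα1 x) (sq_nonneg x)]
  have h2 := postWeight_nonneg hA hA1 x
  split_ifs with hF
  · have h3 : postWeight α x * (1 + x ^ 2) ≤ 1 * (1 + x ^ 2) := by
      gcongr
      exact postWeight_le_one hα hα1 x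
    -- This inequality decouples `x` from the event `F`. Summed over coordinates, it leaves a
    -- bounded fourth-moment term and `n ^ 2` times the probability of `F`.
    have h4 : 2 * (1 + x ^ 2) ≤ (1 + x ^ 2) ^ 2 / n + n := by
      have : (1 + x ^ 2) ^ 2 / n + n - 2 * (1 + x ^ 2) = (1 + x ^ 2 - n) ^ 2 / n := by
        field_simp; ring
      have h5 : 0 ≤ (1 + x ^ 2 - n) ^ 2 / n := by positivity
      linarith
    have h6 : 2816 / n * (1 + x ^ 2) ^ 2 = 2816 * ((1 + x ^ 2) ^ 2 / n) := by ring
    have h7 : 0 ≤ postWeight A x * (1 + x ^ 2) := by positivity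
    have h8 : 0 ≤ 1 + x ^ 2 := by positivity
    rw [h6]
    linarith
  · have h3 : postWeight α x * (1 + x ^ 2) ≤ postWeight A x * (1 + x ^ 2) := by
      gcongr
      exact postWeight_mono hα (h hF) hA1 x
    have h4 : 0 ≤ 2816 / n * (1 + x ^ 2) ^ 2 := by positivity
    linarith

/-- Pointwise bound on the quadratic risk, for a set `L ⊆ I` of large coordinates among the
nonzero ones. -/
lemma sum_risk_le {n : ℕ} (hn : 0 < n) {α A : ℝ} (hα : 0 < α) (hα1 : α ≤ 1) (hA : 0 ≤ A)
    (hA1 : A ≤ 1) {F : Prop} [Decidable F] (hF : ¬ F → α ≤ A) {θ X : Fin n → ℝ}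
    {I L : Finset (Fin n)} (hI : ∀ i ∉ I, θ i = 0) (hL : L ⊆ I) :
    ∑ i, ((1 - postWeight α (X i)) * θ i ^ 2
        + postWeight α (X i) * (2816 + 2 * (X i - θ i) ^ 2)) ≤
      2816 * I.card + ∑ i ∈ I \ L, θ i ^ 2 + L.card * (16 * Real.log (32 / α) + 16)
        + ∑ i ∈ I, 4 * (X i - θ i) ^ 2
        + ∑ i ∈ Iᶜ, (2816 * (postWeight A (X i) * (1 + X i ^ 2))
          + 2816 / n * (1 + X i ^ 2) ^ 2) + if F then 2816 * (n : ℝ) ^ 2 else 0 := by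
  have hn' : (0 : ℝ) < n := by exact_mod_cast hn
  have ha := fun i => postWeight_nonneg hα.le hα1 (X i)
  have ha' := fun i => postWeight_le_one hα.le hα1 (X i)
  have hzero : ∑ i ∈ Iᶜ, ((1 - postWeight α (X i)) * θ i ^ 2
        + postWeight α (X i) * (2816 + 2 * (X i - θ i) ^ 2)) ≤
      ∑ i ∈ Iᶜ, (2816 * (postWeight A (X i) * (1 + X i ^ 2))
          + 2816 / n * (1 + X i ^ 2) ^ 2) + if F then 2816 * (n : ℝ) ^ 2 else 0 := by
    calc _ ≤ ∑ i ∈ Iᶜ, ((2816 * (postWeight A (X i) * (1 + X i ^ 2))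
          + 2816 / n * (1 + X i ^ 2) ^ 2) + if F then 2816 * (n : ℝ) else 0) := by
          refine Finset.sum_le_sum fun i hi => ?_
          rw [hI i (Finset.mem_compl.1 hi)]
          simpa using postWeight_mul_le hα.le hα1 hA hA1 hn' hF (X i)
      _ ≤ _ := by
          rw [Finset.sum_add_distrib, Finset.sum_const, nsmul_eq_mul]
          gcongr
          have hc : ((Iᶜ).card : ℝ) ≤ n := by
            exact_mod_cast (Finset.card_le_univ _).trans_eq (Fintype.card_fin n)
          split_ifs
          · nlinarith
          · simp
  have hsmall : ∑ i ∈ I \ L, ((1 - postWeight α (X i)) * θ i ^ 2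
        + postWeight α (X i) * (2816 + 2 * (X i - θ i) ^ 2)) ≤
      ∑ i ∈ I \ L, (2816 + θ i ^ 2 + 4 * (X i - θ i) ^ 2) := by
    refine Finset.sum_le_sum fun i _ => ?_
    have h1 : (1 - postWeight α (X i)) * θ i ^ 2 ≤ 1 * θ i ^ 2 := by
      gcongr
      linarith [ha i]
    have h2 : postWeight α (X i) * (2816 + 2 * (X i - θ i) ^ 2)
        ≤ 1 * (2816 + 2 * (X i - θ i) ^ 2) := by
      gcongr
      exact ha' i
    linarith [sq_nonneg (X i - θ i)]
  have hlarge : ∑ i ∈ L, ((1 - postWeight α (X i)) * θ i ^ 2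
        + postWeight α (X i) * (2816 + 2 * (X i - θ i) ^ 2)) ≤
      ∑ i ∈ L, (2816 + (16 * Real.log (32 / α) + 16) + 4 * (X i - θ i) ^ 2) := by
    refine Finset.sum_le_sum fun i _ => ?_
    have h1 := one_sub_postWeight_mul_signal_sq_le hα hα1 (X i) (θ i)
    have h2 : postWeight α (X i) * (2816 + 2 * (X i - θ i) ^ 2)
        ≤ 1 * (2816 + 2 * (X i - θ i) ^ 2) := by
      gcongr
      exact ha' i
    linarith
  have hcard : ((I \ L).card : ℝ) + L.card = I.card := by
    exact_mod_cast Finset.card_sdiff_add_card_eq_card hL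
  have hsq : ∑ i ∈ I \ L, 4 * (X i - θ i) ^ 2 + ∑ i ∈ L, 4 * (X i - θ i) ^ 2
      = ∑ i ∈ I, 4 * (X i - θ i) ^ 2 := Finset.sum_sdiff hL
  rw [← Finset.sum_add_sum_compl I, ← Finset.sum_sdiff hL]
  simp only [Finset.sum_add_distrib (s := I \ L), Finset.sum_add_distrib (s := L),
    Finset.sum_const, nsmul_eq_mul] at hsmall hlarge ⊢
  rw [← hcard, ← hsq]
  linarith

lemma log_224_mul_le {n : ℕ} (hn : 0 < n) (hlog : 1 ≤ Real.log n) :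
    Real.log (224 * n) ≤ 7 * Real.log n := by
  have hn' : (0 : ℝ) < n := by exact_mod_cast hn
  rw [Real.log_mul (by norm_num) hn'.ne']
  have h1 : Real.log 224 ≤ Real.log (2 ^ 8) := Real.log_le_log (by norm_num) (by norm_num)
  rw [Real.log_pow] at h1
  push_cast at h1
  linarith [Real.log_two_lt_d9]

lemma mul_exp_neg_div_four_le (k : ℝ) : k * Real.exp (-(k / 4)) ≤ 4 := by
  have h := Real.add_one_le_exp (k / 4)
  rw [Real.exp_neg, ← div_eq_mul_inv, div_le_iff₀ (Real.exp_pos _)]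
  linarith

/-- The coordinates of `K` being large, the logarithm of the estimated weight is controlled up to
an event of small probability. -/
lemma card_mul_log_mle_le {n : ℕ} (hn : 0 < n) {αhat : (Fin n → ℝ) → ℝ} (h : IsMarginalMLE αhat)
    {θ : Fin n → ℝ} {K : Finset (Fin n)}
    (hK : ∀ i ∈ K, 16 * Real.log (1024 * n / K.card) < θ i ^ 2) (X : Fin n → ℝ) :
    K.card * Real.log (32 / αhat X) ≤ K.card * Real.log (1024 * n / K.card) +
      (noisySet θ K (cutoff (K.card / (32 * n)))).indicator
        (fun _ => K.card * Real.log (224 * n)) X := by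
  have hn' : (0 : ℝ) < n := by exact_mod_cast hn
  rcases K.card.eq_zero_or_pos with hK0 | hK0
  · simp [hK0]
  have hK' : (0 : ℝ) < K.card := by exact_mod_cast hK0
  have hKn : (K.card : ℝ) ≤ n := by
    exact_mod_cast (Finset.card_le_univ K).trans_eq (Fintype.card_fin n)
  set α : ℝ := K.card / (32 * n) with hα
  have h0 : 0 < α := by positivity
  have h1 : α ≤ 1 := by
    rw [hα, div_le_one (by positivity)]
    linarith
  have hαeq : 32 / α = 1024 * n / K.card := by rw [hα]; field_simp; norm_num
  have hhat : 0 < αhat X := (alphaMin_pos n).trans_le (h X).1.1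
  have hlog := three_le_log_div h0 h1
  rw [hαeq] at hlog
  by_cases hX : X ∈ noisySet θ K (cutoff α)
  · rw [Set.indicator_of_mem hX, ← mul_add]
    gcongr
    -- On the bad event only the constraint `αhat X ≥ alphaMin n ≥ 1 / (7 n)` is left; `224 = 32 *
    -- 7`.
    have h2 : 32 / αhat X ≤ 224 * n := by
      rw [div_le_iff₀ hhat]
      have h3 := (one_div_le_alphaMin hn).trans (h X).1.1
      rw [div_le_iff₀ (by positivity)] at h3
      linarith
    have h4 : Real.log (32 / αhat X) ≤ Real.log (224 * n) := Real.log_le_log (by positivity) h2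
    linarith
  · rw [Set.indicator_of_notMem hX, add_zero, ← hαeq]
    have hle : α ≤ αhat X := by
      refine le_mle_of_notMem_noisySet h hK0 hα (fun i hi => ?_) hX
      refine abs_le_of_sq_le_sq' ?_ (abs_nonneg _) |>.2
      -- The level `16 log (1024 n / k)` is exactly `(2 * cutoff α) ^ 2` at `α = k / (32 n)`.
      rw [mul_pow, cutoff_sq h0 h1, hαeq, sq_abs]
      linarith [hK i hi]
    gcongr

/-- The risk bound for signals that are not too sparse. -/
lemma postRisk_le {n : ℕ} {αhat : (Fin n → ℝ) → ℝ} (h : IsMarginalMLE αhat) {s : ℝ}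
    (hlog : 1 ≤ Real.log n) (hlarge : 48 * Real.log n ≤ n) (hs : 4 * Real.log n ^ 2 ≤ s)
    (hsn : s ≤ 1 / 10 ^ 10 * n) {θ : Fin n → ℝ} (hθ : θ ∈ sparseVectors n s) :
    postRisk αhat θ ≤ ENNReal.ofReal (10 ^ 9 * rate n s) := by
  classical
  have hs0 : 0 < s := by nlinarith
  have hn' : (0 : ℝ) < n := by linarith
  have hn : 0 < n := by exact_mod_cast hn'
  have hLog := one_le_log_div hs0 hsn
  have hA := upperWeight_pos hs0 hsn
  have hA3 := upperWeight_le hs0 hsn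
  set A := upperWeight n s with hAdef
  set I := Finset.univ.filter fun i => θ i ≠ 0 with hI
  have hIs : (I.card : ℝ) ≤ s := by
    have : ({i | θ i ≠ 0} : Set (Fin n)).ncard = I.card := by
      rw [← Set.ncard_coe_finset, hI]; simp
    rw [← this]
    exact hθ
  obtain ⟨k, hkI, ⟨K, hKI, hKk, hK⟩, L, hLI, hLk, hsum⟩ :=
    exists_large_subset (fun i => θ i ^ 2) (fun j : ℕ => 16 * Real.log (1024 * n / j)) I
  subst hKk
  have hKs : (K.card : ℝ) ≤ s := le_trans (by exact_mod_cast hkI) hIs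
  set N := noisySet θ K (cutoff (K.card / (32 * n))) with hN
  set F := scoreNonnegSet n A with hF
  set c : ℝ := 2816 * s + 144 * (s * Real.log (n / s)) + 16 * (9 * (s * Real.log (n / s)))
    + 16 * s with hc
  -- The estimator is absent from this majorant: what remains is constants, functions of single
  -- coordinates and two indicators. The majorant is measurable even if `αhat` is not.
  have hpoint : ∀ X, ∫⁻ θ', ENNReal.ofReal (∑ i, (θ' i - θ i) ^ 2) ∂posterior (αhat X) X ≤
      ENNReal.ofReal c + ∑ i ∈ I, ENNReal.ofReal 4 * ENNReal.ofReal ((X i - θ i) ^ 2)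
        + ∑ i ∈ Iᶜ, (ENNReal.ofReal 2816 * ENNReal.ofReal (postWeight A (X i) * (1 + X i ^ 2))
          + ENNReal.ofReal (2816 / n) * ENNReal.ofReal ((1 + X i ^ 2) ^ 2))
        + F.indicator (fun _ => ENNReal.ofReal (2816 * n ^ 2)) X
        + N.indicator (fun _ => ENNReal.ofReal (16 * (K.card * Real.log (224 * n)))) X := by
    intro X
    have hα : 0 < αhat X := (alphaMin_pos n).trans_le (h X).1.1
    have hα1 := (h X).1.2
    refine (lintegral_posterior_le hα.le hα1 X θ).trans ?_
    have hr := sum_risk_le hn hα hα1 hA.le (by linarith) (F := X ∈ F) (fun hX =>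
      mle_le_of_notMem_scoreNonnegSet h
        ⟨alphaMin_le_upperWeight hlog hlarge hs hsn, by linarith⟩ hX)
      (θ := θ) (X := X) (I := I) (L := L) (by simp [hI]) hLI
    have hl := card_mul_log_mle_le hn h hK X
    have hlpos := three_le_log_div hα hα1
    have hkl : (L.card : ℝ) * (16 * Real.log (32 / αhat X) + 16)
        ≤ K.card * (16 * Real.log (32 / αhat X) + 16) := by gcongr
    have hmul : K.card * Real.log (1024 * n / K.card) ≤ 9 * (s * Real.log (n / s)) := by
      rcases K.card.eq_zero_or_pos with h0 | h0
      · rw [h0]; simp; positivity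
      · exact mul_log_le hn' hs0 hLog (by exact_mod_cast h0) hKs
    have hsum' := hsum.trans (sum_log_le (k := K.card) hn' hs0 hLog hIs)
    have hind : N.indicator (fun _ => 16 * (K.card * Real.log (224 * n))) X
        = 16 * N.indicator (fun _ => K.card * Real.log (224 * n)) X := by
      by_cases hX : X ∈ N <;> simp [hX]
    have hW : ∑ i, ((1 - postWeight (αhat X) (X i)) * θ i ^ 2
        + postWeight (αhat X) (X i) * (2816 + 2 * (X i - θ i) ^ 2)) ≤
        c + ∑ i ∈ I, 4 * (X i - θ i) ^ 2 + ∑ i ∈ Iᶜ, (2816 * (postWeight A (X i) * (1 + X i ^ 2))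
          + 2816 / n * (1 + X i ^ 2) ^ 2) + (if X ∈ F then 2816 * (n : ℝ) ^ 2 else 0)
        + N.indicator (fun _ => 16 * (K.card * Real.log (224 * n))) X := by
      rw [hind]
      linarith
    refine (ENNReal.ofReal_le_ofReal hW).trans ?_
    refine ENNReal.ofReal_add_le.trans (add_le_add (ENNReal.ofReal_add_le.trans (add_le_add
      (ENNReal.ofReal_add_le.trans (add_le_add (ENNReal.ofReal_add_le.trans (add_le_add le_rfl
      ?_)) ?_)) ?_)) ?_)
    · rw [ENNReal.ofReal_sum_of_nonneg fun i _ => by positivity]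
      exact Finset.sum_le_sum fun i _ => (ENNReal.ofReal_mul (by norm_num)).le
    · have ha := fun i => postWeight_nonneg hA.le (by linarith) (X i)
      rw [ENNReal.ofReal_sum_of_nonneg fun i _ => by have := ha i; positivity]
      refine Finset.sum_le_sum fun i _ => ENNReal.ofReal_add_le.trans (add_le_add ?_ ?_)
      · exact (ENNReal.ofReal_mul (by norm_num)).le
      · exact (ENNReal.ofReal_mul (by positivity)).le
    · by_cases hX : X ∈ F <;> simp [hX]
    · by_cases hX : X ∈ N <;> simp [hX]
  have hmF : MeasurableSet F := measurableSet_scoreNonnegSet n A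
  have hmN : MeasurableSet N := measurableSet_noisySet _ _ _
  have hPF : ENNReal.ofReal (2816 * n ^ 2) * dataLaw θ F ≤ ENNReal.ofReal 2816 := by
    calc _ ≤ ENNReal.ofReal (2816 * n ^ 2) * ENNReal.ofReal (1 / n ^ 2) := by
          gcongr
          exact dataLaw_scoreNonnegSet_upperWeight_le hlog hs hsn hIs
      _ = _ := by
          rw [← ENNReal.ofReal_mul (by positivity)]
          congr 1
          field_simp
  -- The loss `k log (224 n)` meets the probability `exp (-k / 4)`. As `k exp (-k / 4) ≤ 4`, this
  -- costs `O(log n)` uniformly in `k`, and `4 log n ≤ s`.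
  have hPN : ENNReal.ofReal (16 * (K.card * Real.log (224 * n))) * dataLaw θ N
      ≤ ENNReal.ofReal (112 * s) := by
    have hlog224 : 0 ≤ Real.log (224 * n) := Real.log_nonneg (by
      have : (1 : ℝ) ≤ n := by exact_mod_cast hn
      linarith)
    rcases K.card.eq_zero_or_pos with h0 | h0
    · simp [h0]
    have hK0 : (0 : ℝ) < K.card := by exact_mod_cast h0
    have hKn : (K.card : ℝ) ≤ n := by
      exact_mod_cast (Finset.card_le_univ K).trans_eq (Fintype.card_fin n)
    have hα0 : (0 : ℝ) < K.card / (32 * n) := by positivity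
    have hα1 : (K.card : ℝ) / (32 * n) ≤ 1 := by
      rw [div_le_one (by positivity)]; linarith
    have hcut : 8 ≤ cutoff (K.card / (32 * n)) ^ 2 := by
      rw [cutoff_sq hα0 hα1]
      linarith [three_le_log_div hα0 hα1]
    calc _ ≤ ENNReal.ofReal (16 * (K.card * Real.log (224 * n))) *
          ENNReal.ofReal (Real.exp (-(K.card / 4))) := by
          gcongr
          exact dataLaw_noisySet_le θ K hcut (Real.sqrt_nonneg _)
      _ = ENNReal.ofReal (16 * Real.log (224 * n) * (K.card * Real.exp (-(K.card / 4)))) := by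
          rw [← ENNReal.ofReal_mul (by positivity)]
          congr 1
          ring
      _ ≤ _ := by
          refine ENNReal.ofReal_le_ofReal ?_
          calc _ ≤ 16 * Real.log (224 * n) * 4 := by
                gcongr
                exact mul_exp_neg_div_four_le _
            _ ≤ _ := by nlinarith [log_224_mul_le hn hlog]
  have hzero : ∀ i ∈ Iᶜ, ENNReal.ofReal 2816 * ∫⁻ x, ENNReal.ofReal (postWeight A x * (1 + x ^ 2))
        ∂gaussianReal (θ i) 1 + ENNReal.ofReal (2816 / n) * ∫⁻ x, ENNReal.ofReal ((1 + x ^ 2) ^ 2)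
        ∂gaussianReal (θ i) 1
      ≤ ENNReal.ofReal (2816 * (9 * A * cutoff A) + 2816 / n * 128) := by
    intro i hi
    have hi0 : θ i = 0 := by simpa [hI] using hi
    have hcut := one_le_cutoff hA (by linarith)
    rw [hi0, ENNReal.ofReal_add (by positivity) (by positivity),
      ENNReal.ofReal_mul (p := 2816) (by norm_num),
      ENNReal.ofReal_mul (p := 2816 / (n : ℝ)) (by positivity)]
    gcongr
    · exact lintegral_postWeight_mul_le hA (by linarith)
    · exact lintegral_gaussianReal_one_add_sq_sq_le
  have hcut := one_le_cutoff hA (by linarith)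
  calc postRisk αhat θ
      ≤ ∫⁻ X, (ENNReal.ofReal c + ∑ i ∈ I, ENNReal.ofReal 4 * ENNReal.ofReal ((X i - θ i) ^ 2)
        + ∑ i ∈ Iᶜ, (ENNReal.ofReal 2816 * ENNReal.ofReal (postWeight A (X i) * (1 + X i ^ 2))
          + ENNReal.ofReal (2816 / n) * ENNReal.ofReal ((1 + X i ^ 2) ^ 2))
        + F.indicator (fun _ => ENNReal.ofReal (2816 * n ^ 2)) X
        + N.indicator (fun _ => ENNReal.ofReal (16 * (K.card * Real.log (224 * n)))) X)
          ∂dataLaw θ := lintegral_mono hpoint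
    _ = ENNReal.ofReal c + ∑ i ∈ I, ENNReal.ofReal 4 *
          ∫⁻ x, ENNReal.ofReal ((x - θ i) ^ 2) ∂gaussianReal (θ i) 1
        + ∑ i ∈ Iᶜ, (ENNReal.ofReal 2816 * ∫⁻ x, ENNReal.ofReal (postWeight A x * (1 + x ^ 2))
            ∂gaussianReal (θ i) 1
          + ENNReal.ofReal (2816 / n) * ∫⁻ x, ENNReal.ofReal ((1 + x ^ 2) ^ 2)
            ∂gaussianReal (θ i) 1)
        + ENNReal.ofReal (2816 * n ^ 2) * dataLaw θ F
        + ENNReal.ofReal (16 * (K.card * Real.log (224 * n))) * dataLaw θ N := by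
        rw [lintegral_add_right _ (measurable_const.indicator hmN),
          lintegral_add_right _ (measurable_const.indicator hmF),
          lintegral_add_right _ (by fun_prop), lintegral_add_right _ (by fun_prop),
          lintegral_const, measure_univ, mul_one, lintegral_indicator_const hmN,
          lintegral_indicator_const hmF, lintegral_finsetSum _ (fun i _ => by fun_prop),
          lintegral_finsetSum _ (fun i _ => by fun_prop)]
        congr 4
        · refine Finset.sum_congr rfl fun i _ => ?_
          rw [lintegral_const_mul _ (by fun_prop), lintegral_dataLaw_eval θ i
            (f := fun x => ENNReal.ofReal ((x - θ i) ^ 2)) (by fun_prop)]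
        · refine funext fun i => ?_
          rw [lintegral_add_right _ (by fun_prop), lintegral_const_mul _ (by fun_prop),
            lintegral_const_mul _ (by fun_prop), lintegral_dataLaw_eval θ i
            (f := fun x => ENNReal.ofReal ((1 + x ^ 2) ^ 2)) (by fun_prop),
            lintegral_dataLaw_eval θ i
            (f := fun x => ENNReal.ofReal (postWeight A x * (1 + x ^ 2))) (by fun_prop)]
    _ ≤ ENNReal.ofReal c + ∑ i ∈ I, ENNReal.ofReal 4
        + ∑ i ∈ Iᶜ, ENNReal.ofReal (2816 * (9 * A * cutoff A) + 2816 / n * 128)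
        + ENNReal.ofReal 2816 + ENNReal.ofReal (112 * s) := by
        gcongr with i hi i hi
        · exact mul_le_of_le_one_right (by positivity) (lintegral_gaussianReal_sub_sq_le _)
        · exact hzero i hi
    _ = ENNReal.ofReal (c + I.card * 4
        + (Iᶜ).card * (2816 * (9 * A * cutoff A) + 2816 / n * 128) + 2816 + 112 * s) := by
        have hc0 : 0 ≤ c := by positivity
        have hw : 0 ≤ 2816 * (9 * A * cutoff A) + 2816 / n * 128 := by positivity
        clear_value c
        generalize 2816 * (9 * A * cutoff A) + 2816 / n * 128 = w at hw ⊢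
        rw [Finset.sum_const, Finset.sum_const, nsmul_eq_mul, nsmul_eq_mul,
          ENNReal.ofReal_add (by positivity) (by positivity),
          ENNReal.ofReal_add (by positivity) (by positivity),
          ENNReal.ofReal_add (by positivity) (by positivity),
          ENNReal.ofReal_add (by positivity) (by positivity),
          ENNReal.ofReal_mul (p := (I.card : ℝ)) (by positivity),
          ENNReal.ofReal_mul (p := ((Iᶜ).card : ℝ)) (by positivity),
          ENNReal.ofReal_natCast, ENNReal.ofReal_natCast]
    _ ≤ _ := by
        refine ENNReal.ofReal_le_ofReal ?_
        have hcard : ((Iᶜ).card : ℝ) ≤ n := by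
          exact_mod_cast (Finset.card_le_univ _).trans_eq (Fintype.card_fin n)
        -- The dominant term: zero coordinates give `25344 * 40960`, slightly above `10 ^ 9`, times
        -- `s log (n / s)`, while `rate` carries a factor `2`.
        have hAc : n * (A * cutoff A) ≤ 40960 * (s * Real.log (n / s)) := by
          calc n * (A * cutoff A) ≤ n * (A * (2 * √(Real.log (n / s)))) := by
                gcongr
                exact cutoff_upperWeight_le hs0 hsn
            _ = 40960 * (s * (√(Real.log (n / s)) * √(Real.log (n / s)))) := by
                rw [hAdef, upperWeight]; field_simp; norm_num
            _ = _ := by rw [Real.mul_self_sqrt (by linarith)]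
        have h1 : ((Iᶜ).card : ℝ) * (2816 * (9 * A * cutoff A) + 2816 / n * 128)
            ≤ n * (2816 * (9 * A * cutoff A) + 2816 / n * 128) := by gcongr
        have h2 : n * (2816 * (9 * A * cutoff A) + 2816 / n * 128)
            = 25344 * (n * (A * cutoff A)) + 360448 := by field_simp; ring
        have h3 : s ≤ s * Real.log (n / s) := le_mul_of_one_le_right hs0.le hLog
        have h4 : 4 ≤ s := by nlinarith
        rw [rate]
        linarith

lemma eventually_log_bounds : ∀ᶠ n : ℕ in Filter.atTop, 1 ≤ Real.log n ∧ 48 * Real.log n ≤ n ∧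
    4 * Real.log n ^ 2 ≤ 1 / 10 ^ 10 * n := by
  have h1 : Filter.Tendsto (fun n : ℕ => Real.log n) Filter.atTop Filter.atTop :=
    Real.tendsto_log_atTop.comp tendsto_natCast_atTop_atTop
  have h2 : ∀ᶠ n : ℕ in Filter.atTop, ‖Real.log n ^ 2‖ ≤ 1 / 10 ^ 12 * ‖(n : ℝ)‖ :=
    tendsto_natCast_atTop_atTop.eventually
      ((Real.isLittleO_pow_log_id_atTop (n := 2)).bound (by norm_num : (0 : ℝ) < 1 / 10 ^ 12))
  filter_upwards [h1.eventually_ge_atTop 1, h2] with n hn1 hn2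
  rw [Real.norm_of_nonneg (by positivity), Real.norm_of_nonneg (by positivity)] at hn2
  have hn0 : (0 : ℝ) ≤ n := Nat.cast_nonneg n
  refine ⟨hn1, ?_, ?_⟩ <;> nlinarith

end SpikeSlab

theorem theorem3 :
    ∃ (C c₀ c₁ : ℝ) (N₀ : ℕ), 0 < C ∧ 0 < c₀ ∧ 0 < c₁ ∧ 0 < N₀ ∧
      ∀ n : ℕ, N₀ ≤ n →
        ∀ αhat : (Fin n → ℝ) → ℝ, SpikeSlab.IsMarginalMLE αhat →
          ∀ s : ℝ, 0 ≤ s → s ≤ c₀ * n →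
            (c₁ * Real.log n ^ 2 ≤ s →
              (⨆ θ₀ ∈ SpikeSlab.sparseVectors n s, SpikeSlab.postRisk αhat θ₀)
                ≤ ENNReal.ofReal (C * SpikeSlab.rate n s)) ∧
            (⨆ θ₀ ∈ SpikeSlab.sparseVectors n s, SpikeSlab.postRisk αhat θ₀)
              ≤ ENNReal.ofReal (C * SpikeSlab.rate n s + C * Real.log n ^ 3) := by
  obtain ⟨N, hN⟩ := Filter.eventually_atTop.1 SpikeSlab.eventually_log_bounds
  refine ⟨10 ^ 10, 1 / 10 ^ 10, 4, N + 1, by norm_num, by norm_num, by norm_num, by lia, ?_⟩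
  intro n hn αhat h s hs hsn
  obtain ⟨hlog, hlarge, hlog2⟩ := hN n (by lia)
  have hn0 : (0 : ℝ) < n := by linarith
  have hrate : 0 ≤ SpikeSlab.rate n s := by
    rcases hs.eq_or_lt with rfl | hs0
    · simp [SpikeSlab.rate]
    · have := SpikeSlab.one_le_log_div hs0 hsn
      unfold SpikeSlab.rate
      positivity
  have hdense : 4 * Real.log n ^ 2 ≤ s →
      (⨆ θ₀ ∈ SpikeSlab.sparseVectors n s, SpikeSlab.postRisk αhat θ₀)
        ≤ ENNReal.ofReal (10 ^ 10 * SpikeSlab.rate n s) := fun hs' =>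
    iSup₂_le fun θ hθ => (SpikeSlab.postRisk_le h hlog hlarge hs' hsn hθ).trans
      (ENNReal.ofReal_le_ofReal (by linarith))
  refine ⟨hdense, ?_⟩
  rcases le_total (4 * Real.log n ^ 2) s with hs' | hs'
  · exact (hdense hs').trans (ENNReal.ofReal_le_ofReal (le_add_of_nonneg_right (by positivity)))
  -- The sparse regime embeds in the class of sparsity `4 log² n`, still below `n / 10 ^ 10`. Its
  -- rate is at most `8 log³ n`, which the extra factor `10` in `C` absorbs.
  · refine iSup₂_le fun θ hθ => (SpikeSlab.postRisk_le h hlog hlarge le_rfl hlog2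
      (le_trans (show _ ≤ s from hθ) hs')).trans (ENNReal.ofReal_le_ofReal ?_)
    have h1 : Real.log (n / (4 * Real.log n ^ 2)) ≤ Real.log n :=
      Real.log_le_log (by positivity) (div_le_self hn0.le (by nlinarith))
    have h2 : SpikeSlab.rate n (4 * Real.log n ^ 2) ≤ 8 * Real.log n ^ 3 := by
      calc _ ≤ 2 * (4 * Real.log n ^ 2) * Real.log n := by unfold SpikeSlab.rate; gcongr
        _ = _ := by ring
    have h3 : 0 ≤ Real.log n ^ 3 := by positivity
    linarith
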